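/- Let $\alpha>0$ and let $G^2_\alpha$ be the $\alpha$-Grushin plane, i.e. $\mathbb{R}^2$ with the vector fields $X=\partial_x$, $Y_\alpha=|x|^\alpha\partial_y$. For open $U\subset\mathbb{R}^2$ and $1\le p<\infty$, $HW^{1,p}(U)$ is the set of $f\in L^p(U)$ (Lebesgue measure) whose first weak partial derivatives exist and satisfy $\partial_xf,\ |x|^\alpha\partial_yf\in L^p(U)$. For open $\Omega,\Omega'\subset\mathbb{R}^2$, a map $g=(g_1,g_2):\Omega\to\Omega'$ is in $HW^{1,p}_{\rm loc}(\Omega,\Omega')$ if $g_1,g_2\in HW^{1,p}(U)$ for all open $U$ with compact closure $\overline U\subset\Omega$. Put $S_g=\{(x,y)\in\Omega : x=0 \text{ or } g_1(x,y)=0\}$, $R_g=\Omega\setminus S_g$ and, with classical partial derivatives, $$D_Hg=\begin{bmatrix}Xg_1&Y_\alpha g_1\\ Xg_2&Y_\alpha g_2\end{bmatrix},\qquad D_\alpha g=\begin{bmatrix}Xg_1&Y_\alpha g_1\\ |g_1|^{-\alpha}Xg_2&|g_1|^{-\alpha}Y_\alpha g_2\end{bmatrix}.$$ A map $g\in HW^{1,1}_{\rm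 loc}(\Omega,\Omega')$ is orientation preserving if $\det D_Hg>0$ a.e. in $\Omega$. A homeomorphism $g$ of $\Omega$ onto $\Omega'$ with $g\in HW^{1,2}_{\rm loc}(\Omega,\Omega')$ is conformal if (1) a.e. in $R_g$ the matrix $D_\alpha g$ is a positive multiple of an orthogonal matrix, and (2) for every $q\in S_g$ the limit of $D_\alpha g$ at $q$ along $R_g$ is defined, finite and non-zero. Let $\varphi_\alpha:\mathbb{R}^2\to\mathbb{C}$, $\varphi_\alpha(x,y)=\frac{x|x|^\alpha}{\alpha+1}+iy$, be the Meyerson map, which is a homeomorphism. A biholomorphism between open subsets of $\mathbb{C}$ is a holomorphic homeomorphism of one onto the other. **Theorem.** Let $\Omega,\Omega'\subset G^2_\alpha$ be open. Then $g\mapsto\widetilde g=\varphi_\alpha\circ g\circ\varphi_\alpha^{-1}$ is a bijection from the set of orientation preserving conformal maps $g:\Omega\to\Omega'$ with $g\in HW^{1,2(\alpha+1)/\alpha}_{\rm loc}(\Omega,\Omega')$ onto the set of biholomorphisms $\widetilde g:\varphi_\alpha(\Omega)\to\varphi_\alpha(\Omega')$ such that, for $z\in\varphi_\alpha(\Omega)$,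 $\operatorname{Re}\widetilde g(z)=0$ if and only if $\operatorname{Re}z=0$. Moreover, every such $g=(g_1,g_2)$ satisfies, for $(x,y)\in\Omega$, $g_1(x,y)=0$ if and only if $x=0$. -/

import Mathlib

open MeasureTheory Filter Topology
open scoped ContDiff

namespace Grushin

noncomputable section

/-! ### The Meyerson map -/

/-- The real function `x ↦ x |x|^α / (α + 1)`. -/
def stretch (α x : ℝ) : ℝ := x * |x| ^ α / (α + 1)

/-- The real function `x ↦ sign(x) [(α + 1) |x|]^{1/(α+1)}`, the inverse of `stretch α`. -/
def unstretch (α x : ℝ) : ℝ := Real.sign x * ((α + 1) * |x|) ^ (1 / (α + 1))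

theorem unstretch_stretch {α : ℝ} (hα : 0 < α) (x : ℝ) : unstretch α (stretch α x) = x := by
  have h1 : (0 : ℝ) < α + 1 := by linarith
  have key : ∀ y : ℝ, 0 < y → ((α + 1) * |y * y ^ α / (α + 1)|) ^ (1 / (α + 1)) = y := by
    intro y hy
    have hp : 0 < y ^ α := Real.rpow_pos_of_pos hy α
    rw [abs_of_pos (by positivity)]
    have : (α + 1) * (y * y ^ α / (α + 1)) = y ^ (α + 1) := by
      rw [Real.rpow_add hy, Real.rpow_one]; field_simp
    rw [this, ← Real.rpow_mul hy.le, mul_one_div_cancel h1.ne', Real.rpow_one]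
  unfold unstretch stretch
  rcases lt_trichotomy x 0 with hx | hx | hx
  · have hx' : 0 < -x := by linarith
    have hp : 0 < (-x) ^ α := Real.rpow_pos_of_pos hx' α
    have hneg : x * |x| ^ α / (α + 1) < 0 := by
      rw [abs_of_neg hx]
      exact div_neg_of_neg_of_pos (mul_neg_of_neg_of_pos hx hp) h1
    rw [Real.sign_of_neg hneg, abs_of_neg hx]
    have h2 : x * (-x) ^ α / (α + 1) = -((-x) * (-x) ^ α / (α + 1)) := by ring
    rw [h2, abs_neg, key _ hx']; ring
  · subst hx; simp
  · have hp : 0 < x ^ α := Real.rpow_pos_of_pos hx α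
    rw [abs_of_pos hx, Real.sign_of_pos (by positivity), key _ hx, one_mul]

theorem stretch_unstretch {α : ℝ} (hα : 0 < α) (x : ℝ) : stretch α (unstretch α x) = x := by
  have h1 : (0 : ℝ) < α + 1 := by linarith
  have key : ∀ y : ℝ, 0 < y →
      ((α + 1) * y) ^ (1 / (α + 1)) * (((α + 1) * y) ^ (1 / (α + 1))) ^ α / (α + 1) = y := by
    intro y hy
    have hz : 0 < (α + 1) * y := by positivity
    rw [← Real.rpow_mul hz.le, ← Real.rpow_add hz]
    have : 1 / (α + 1) + 1 / (α + 1) * α = 1 := by field_simp; ring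
    rw [this, Real.rpow_one]; field_simp
  unfold unstretch stretch
  rcases lt_trichotomy x 0 with hx | hx | hx
  · have hx' : 0 < -x := by linarith
    have hp : 0 < ((α + 1) * -x) ^ (1 / (α + 1)) := Real.rpow_pos_of_pos (by positivity) _
    rw [Real.sign_of_neg hx, abs_of_neg hx, neg_one_mul, abs_neg, abs_of_pos hp, neg_mul, neg_div,
      key _ hx', neg_neg]
  · subst hx; simp
  · have hp : 0 < ((α + 1) * x) ^ (1 / (α + 1)) := Real.rpow_pos_of_pos (by positivity) _
    rw [Real.sign_of_pos hx, abs_of_pos hx, one_mul, abs_of_pos hp, key _ hx]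

theorem continuous_stretch {α : ℝ} (hα : 0 < α) : Continuous (stretch α) := by
  unfold stretch
  exact (continuous_id.mul (continuous_abs.rpow_const fun _ => Or.inr hα.le)).div_const _

theorem continuous_unstretch {α : ℝ} (hα : 0 < α) : Continuous (unstretch α) := by
  have h1 : (0 : ℝ) < 1 / (α + 1) := by positivity
  have h : unstretch α = fun x => ((α + 1) * max x 0) ^ (1 / (α + 1)) -
      ((α + 1) * max (-x) 0) ^ (1 / (α + 1)) := by
    funext x
    unfold unstretch
    rcases lt_trichotomy x 0 with hx | hx | hx
    · rw [Real.sign_of_neg hx, abs_of_neg hx, max_eq_right hx.le, max_eq_left (by linarith),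
        mul_zero, Real.zero_rpow h1.ne']; ring
    · subst hx; simp
    · rw [Real.sign_of_pos hx, abs_of_pos hx, max_eq_left hx.le, max_eq_right (by linarith),
        mul_zero, Real.zero_rpow h1.ne']; ring
  rw [h]
  exact ((continuous_const.mul (continuous_id.max continuous_const)).rpow_const
      fun _ => Or.inr h1.le).sub
    ((continuous_const.mul (continuous_neg.max continuous_const)).rpow_const
      fun _ => Or.inr h1.le)

/-- The Meyerson map `φ_α (x, y) = x |x|^α / (α + 1) + i y`, a homeomorphism from the
`α`-Grushin plane (as a set and as a topological space, `ℝ × ℝ`) onto `ℂ`. -/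
def meyerson (α : ℝ) (hα : 0 < α) : (ℝ × ℝ) ≃ₜ ℂ where
  toFun p := ⟨stretch α p.1, p.2⟩
  invFun z := (unstretch α z.re, z.im)
  left_inv p := by simp [unstretch_stretch hα]
  right_inv z := by simp [stretch_unstretch hα]
  continuous_toFun := by
    have := (continuous_stretch hα).comp (continuous_fst (X := ℝ) (Y := ℝ))
    exact Complex.equivRealProdCLM.symm.continuous.comp (this.prodMk continuous_snd)
  continuous_invFun :=
    ((continuous_unstretch hα).comp Complex.continuous_re).prodMk Complex.continuous_im

/-- The conjugate `φ_α ∘ g ∘ φ_α⁻¹ : φ_α(Ω) → φ_α(Ω')` of a homeomorphism `g : Ω → Ω'`. -/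
def conjugate (α : ℝ) (hα : 0 < α) {Ω Ω' : Set (ℝ × ℝ)} (g : Ω ≃ₜ Ω') :
    (meyerson α hα '' Ω) ≃ₜ (meyerson α hα '' Ω') :=
  (((meyerson α hα).image Ω).symm.trans g).trans ((meyerson α hα).image Ω')

/-! ### Horizontal Sobolev spaces -/

/-- `u` is the weak derivative of `f` in the direction `e` on the open set `U ⊆ ℝ²`. -/
def IsWeakDeriv (U : Set (ℝ × ℝ)) (e : ℝ × ℝ) (f u : ℝ × ℝ → ℝ) : Prop :=
  LocallyIntegrableOn f U volume ∧ LocallyIntegrableOn u U volume ∧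
    ∀ ψ : ℝ × ℝ → ℝ, ContDiff ℝ ∞ ψ → HasCompactSupport ψ → tsupport ψ ⊆ U →
      ∫ p in U, f p * fderiv ℝ ψ p e = -∫ p in U, u p * ψ p

/-- The horizontal Sobolev space `HW^{1,p,α}(U)`: `f ∈ L^p(U)`, the weak partial derivatives
`u = ∂f/∂x` and `v = ∂f/∂y` exist on `U`, and the horizontal gradient `(u, |x|^α v)` is in
`L^p(U)`. -/
def MemHW (α : ℝ) (p : ENNReal) (U : Set (ℝ × ℝ)) (f : ℝ × ℝ → ℝ) : Prop :=
  MemLp f p (volume.restrict U) ∧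
    ∃ u v : ℝ × ℝ → ℝ, IsWeakDeriv U (1, 0) f u ∧ IsWeakDeriv U (0, 1) f v ∧
      MemLp u p (volume.restrict U) ∧
      MemLp (fun q => |q.1| ^ α * v q) p (volume.restrict U)

/-- The map `g : Ω → Ω'` as a map of the plane, extended by zero outside `Ω`; only its values on
`Ω` (and, `Ω` being open, its derivatives there) are used below. -/
def ext {Ω Ω' : Set (ℝ × ℝ)} (g : Ω ≃ₜ Ω') : ℝ × ℝ → ℝ × ℝ :=
  Function.extend Subtype.val (fun p : Ω => (g p : ℝ × ℝ)) 0

/-- First component `g₁` of `g`. -/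
def comp₁ {Ω Ω' : Set (ℝ × ℝ)} (g : Ω ≃ₜ Ω') (p : ℝ × ℝ) : ℝ := (ext g p).1

/-- Second component `g₂` of `g`. -/
def comp₂ {Ω Ω' : Set (ℝ × ℝ)} (g : Ω ≃ₜ Ω') (p : ℝ × ℝ) : ℝ := (ext g p).2

/-- `g ∈ HW^{1,p,α}_loc(Ω, Ω')`: both components are in `HW^{1,p,α}(U)` for every open `U`
whose (Euclidean) closure is compact and contained in `Ω`. -/
def MemHWLoc (α : ℝ) (p : ENNReal) {Ω Ω' : Set (ℝ × ℝ)} (g : Ω ≃ₜ Ω') : Prop :=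
  ∀ U : Set (ℝ × ℝ), IsOpen U → IsCompact (closure U) → closure U ⊆ Ω →
    MemHW α p U (comp₁ g) ∧ MemHW α p U (comp₂ g)

/-! ### Grushin-conformal maps -/

/-- The (classical) derivative `X f = ∂f/∂x`. -/
def X (f : ℝ × ℝ → ℝ) (p : ℝ × ℝ) : ℝ := deriv (fun t => f (t, p.2)) p.1

/-- The (classical) derivative `Y_α f = |x|^α ∂f/∂y`. -/
def Y (α : ℝ) (f : ℝ × ℝ → ℝ) (p : ℝ × ℝ) : ℝ := |p.1| ^ α * deriv (fun t => f (p.1, t)) p.2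

/-- Both classical partial derivatives of `f` exist at `p`. -/
def HasPartials (f : ℝ × ℝ → ℝ) (p : ℝ × ℝ) : Prop :=
  DifferentiableAt ℝ (fun t => f (t, p.2)) p.1 ∧ DifferentiableAt ℝ (fun t => f (p.1, t)) p.2

section Maps

variable {Ω Ω' : Set (ℝ × ℝ)}

/-- The set of points of `Ω` at which all classical partial derivatives of `g` exist. -/
def partialsSet (g : Ω ≃ₜ Ω') : Set (ℝ × ℝ) :=
  {p ∈ Ω | HasPartials (comp₁ g) p ∧ HasPartials (comp₂ g) p}

/-- The singular set `S_g = {(x, y) ∈ Ω | x = 0 or g₁(x, y) = 0}`. -/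
def singularSet (g : Ω ≃ₜ Ω') : Set (ℝ × ℝ) := {p ∈ Ω | p.1 = 0 ∨ comp₁ g p = 0}

/-- The regular set `R_g = Ω \ S_g`. -/
def regularSet (g : Ω ≃ₜ Ω') : Set (ℝ × ℝ) := Ω \ singularSet g

/-- The matrix `D_H g`. -/
def horizontalMatrix (α : ℝ) (g : Ω ≃ₜ Ω') (p : ℝ × ℝ) : Matrix (Fin 2) (Fin 2) ℝ :=
  !![X (comp₁ g) p, Y α (comp₁ g) p;
     X (comp₂ g) p, Y α (comp₂ g) p]

/-- The matrix `D_α g`, meaningful where `g₁ ≠ 0`. -/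
def grushinMatrix (α : ℝ) (g : Ω ≃ₜ Ω') (p : ℝ × ℝ) : Matrix (Fin 2) (Fin 2) ℝ :=
  !![X (comp₁ g) p, Y α (comp₁ g) p;
     X (comp₂ g) p / |comp₁ g p| ^ α, Y α (comp₂ g) p / |comp₁ g p| ^ α]

/-- Orientation preserving: `g ∈ HW^{1,1}_loc` and `J_g = det D_H g > 0` almost everywhere in
`Ω`. -/
def IsOrientationPreserving (α : ℝ) (g : Ω ≃ₜ Ω') : Prop :=
  MemHWLoc α 1 g ∧
    ∀ᵐ p : ℝ × ℝ, p ∈ Ω → p ∈ partialsSet g ∧ 0 < (horizontalMatrix α g p).det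

/-- Conformality in the Grushin plane of the homeomorphism `g : Ω → Ω'`: `g ∈ HW^{1,2}_loc`;
`D_α g` is almost everywhere in `R_g` a positive multiple of an orthogonal matrix; and at every
point of `S_g` the matrix `D_α g` has a finite nonzero limit along `R_g`. The limit is taken along
the points of `R_g` at which the entries of `D_α g` are defined, and being defined includes that
the point is an accumulation point of these. -/
structure IsConformal (α : ℝ) (g : Ω ≃ₜ Ω') : Prop where
  memHWLoc : MemHWLoc α 2 g
  orthogonal : ∀ᵐ p : ℝ × ℝ, p ∈ regularSet g → p ∈ partialsSet g ∧
    ∃ c : ℝ, 0 < c ∧ ∃ O ∈ Matrix.orthogonalGroup (Fin 2) ℝ, grushinMatrix α g p = c • O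
  limit : ∀ p₀ ∈ singularSet g, (𝓝[regularSet g ∩ partialsSet g] p₀).NeBot ∧
    ∃ L : Matrix (Fin 2) (Fin 2) ℝ, L ≠ 0 ∧
      Tendsto (grushinMatrix α g) (𝓝[regularSet g ∩ partialsSet g] p₀) (𝓝 L)

end Maps

/-- The orientation preserving conformal maps `g : Ω → Ω'` of class `HW^{1, 2(α+1)/α}_loc`. -/
def grushinConformalMaps (α : ℝ) (Ω Ω' : Set (ℝ × ℝ)) : Set (Ω ≃ₜ Ω') :=
  {g | IsConformal α g ∧ IsOrientationPreserving α g ∧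
    MemHWLoc α (ENNReal.ofReal (2 * (α + 1) / α)) g}

/-! ### Conformal maps in the complex plane -/

/-- A homeomorphism `h : U → V` between open subsets of `ℂ` is a biholomorphism if it is
holomorphic on `U` (here `h` is extended by zero outside `U`). -/
def IsBiholomorphism {U V : Set ℂ} (h : U ≃ₜ V) : Prop :=
  DifferentiableOn ℂ (Function.extend Subtype.val (fun z : U => (h z : ℂ)) 0) U

/-- The biholomorphisms `h : U → V` such that `Re h(z) = 0` if and only if `Re z = 0`. -/
def axisBiholomorphisms (U V : Set ℂ) : Set (U ≃ₜ V) :=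
  {h | IsBiholomorphism h ∧ ∀ z : U, (h z : ℂ).re = 0 ↔ (z : ℂ).re = 0}

end

end Grushin

namespace Grushin

/-! ### One-dimensional weak derivatives -/

/-! Both classes of maps are identified with one condition, `IsAxisBiholomorphic`: the conjugate map
F = φ ∘ g ∘ φ⁻¹ is holomorphic, and g₁ vanishes exactly on the axis x = 0. Conjugation by the
homeomorphism φ is a bijection on all homeomorphisms, so the theorem follows.

From conformal to holomorphic. A positive multiple of an orthogonal matrix with positive determinant
is a multiple of a rotation, so almost everywhere |x|^α ∂_y g₂ = |g₁|^α ∂_x g₁ and |x|^α |g₁|^α ∂_y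
g₁ = -∂_x g₂. The set {g₁ = 0} does not matter: almost everywhere on it the partial derivatives of
g₁ vanish, which contradicts the positive determinant. For U = `stretch α` ∘ g₁ and V = g₂ these are
the Cauchy-Riemann equations pulled back by φ. A continuous Sobolev function is absolutely
continuous on almost all lines, so Fubini turns the equations into vanishing boundary integrals over
rectangles, and Morera's theorem shows that F is holomorphic (`differentiableOn_of_cauchyRiemann`,
`isBiholomorphism_conjugate`).

The axis. Where x and g₁ are nonzero, D_α g equals (|x| / |g₁|)^α times the matrix of multiplication
by F' (`grushinMatrix_eq`), and F' has no zeros because F is a homeomorphism. If exactly one of x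
and g₁ vanished at a point, D_α g would tend to zero or be unbounded there, against the limit
condition (`comp₁_eq_zero_iff`).

From holomorphic to conformal. If F preserves the imaginary axis, then Re F / Re z tends to F',
which is real and nonzero on the axis, so (|x| / |g₁|)^α has a positive limit there
(`exists_tendsto_ratio`). Moreover Im F' vanishes on the axis, hence is O(|Re z|) = O(|x|^(α+1)). So
all partial derivatives of g are locally bounded off the axis, and g lies in HW^{1,p}_loc for every
p (`IsAxisBiholomorphic.memHWLoc`), in particular for p = 1, 2 and 2(α+1)/α. -/

theorem exists_subset_Icc_of_isCompact_subset_Ioo {a b : ℝ} (hab : a < b) {K : Set ℝ}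
    (hK : IsCompact K) (hKab : K ⊆ Set.Ioo a b) :
    ∃ a' b', a < a' ∧ b' < b ∧ K ⊆ Set.Icc a' b' := by
  rcases K.eq_empty_or_nonempty with rfl | hne
  · exact ⟨(a + b) / 2, (a + b) / 2, by linarith, by linarith, Set.empty_subset _⟩
  · refine ⟨sInf K, sSup K, (hKab (hK.sInf_mem hne)).1, (hKab (hK.sSup_mem hne)).2, fun x hx => ?_⟩
    exact ⟨csInf_le hK.bddBelow hx, le_csSup hK.bddAbove hx⟩

/-- A test function on an interval with vanishing integral is the derivative of a test function. -/
theorem exists_deriv_eq_of_integral_eq_zero {a b : ℝ} (hab : a < b) {σ : ℝ → ℝ}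
    (hσ : ContDiff ℝ ∞ σ) (hc : HasCompactSupport σ) (hs : tsupport σ ⊆ Set.Ioo a b)
    (h0 : ∫ x, σ x = 0) :
    ∃ χ : ℝ → ℝ, ContDiff ℝ ∞ χ ∧ HasCompactSupport χ ∧ tsupport χ ⊆ Set.Ioo a b ∧
      deriv χ = σ := by
  obtain ⟨a', b', ha', hb', hsub⟩ := exists_subset_Icc_of_isCompact_subset_Ioo hab hc hs
  have hder : ∀ x, HasDerivAt (fun x => ∫ t in a..x, σ t) (σ x) x := fun x =>
    intervalIntegral.integral_hasDerivAt_right (hσ.continuous.intervalIntegrable _ _)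
      (hσ.continuous.stronglyMeasurableAtFilter _ _) hσ.continuous.continuousAt
  have hder' : deriv (fun x => ∫ t in a..x, σ t) = σ := funext fun x => (hder x).deriv
  have hsupp : Function.support (fun x => ∫ t in a..x, σ t) ⊆ Set.Icc a' b' := by
    intro x hx
    by_contra hx'
    apply hx
    have hzero : ∀ t, t ∉ Set.Icc a' b' → σ t = 0 := fun t ht =>
      image_eq_zero_of_notMem_tsupport fun h => ht (hsub h)
    rcases lt_or_ge x a' with h | h
    · have : ∫ t in a..x, σ t = ∫ t in a..x, (0 : ℝ) := by
        refine intervalIntegral.integral_congr fun t ht => hzero t fun h' => ?_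
        have := ht.2
        have := h'.1
        rcases le_total a x with hax | hax <;> simp_all <;> linarith
      simpa using this
    · have hbx : b' < x := by
        by_contra hcon
        exact hx' ⟨h, not_lt.mp hcon⟩
      change ∫ t in a..x, σ t = 0
      rw [intervalIntegral.integral_eq_integral_of_support_subset, h0]
      intro t ht
      have := hsub (subset_tsupport _ ht)
      exact ⟨by linarith [this.1], by linarith [this.2]⟩
  refine ⟨fun x => ∫ t in a..x, σ t, ?_, ?_, ?_, hder'⟩
  · exact contDiff_infty_iff_deriv.2 ⟨fun x => (hder x).differentiableAt, by rwa [hder']⟩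
  · exact HasCompactSupport.of_support_subset_isCompact isCompact_Icc hsupp
  · exact (closure_minimal hsupp isClosed_Icc).trans fun x hx =>
      ⟨by linarith [hx.1], by linarith [hx.2]⟩

/-- The lemma of du Bois-Reymond. -/
theorem exists_eqOn_const_of_integral_mul_deriv_eq_zero {a b : ℝ} (hab : a < b) {M : ℝ → ℝ}
    (hM : ContinuousOn M (Set.Icc a b))
    (h : ∀ χ : ℝ → ℝ, ContDiff ℝ ∞ χ → HasCompactSupport χ → tsupport χ ⊆ Set.Ioo a b →
      ∫ x in Set.Ioo a b, M x * deriv χ x = 0) :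
    ∃ c, ∀ x ∈ Set.Ioo a b, M x = c := by
  have hMi : IntegrableOn M (Set.Ioo a b) :=
    (hM.integrableOn_compact isCompact_Icc).mono_set Set.Ioo_subset_Icc_self
  have hmul : ∀ ρ : ℝ → ℝ, Continuous ρ →
      IntegrableOn (fun x => M x * ρ x) (Set.Ioo a b) := fun ρ hρ =>
    ((hM.mul hρ.continuousOn).integrableOn_compact isCompact_Icc).mono_set Set.Ioo_subset_Icc_self
  let β : ContDiffBump ((a + b) / 2) :=
    { rIn := (b - a) / 8, rOut := (b - a) / 4, rIn_pos := by linarith, rIn_lt_rOut := by linarith }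
  set ρ₀ : ℝ → ℝ := β.normed volume with hρ₀
  have hβ1 : ContDiff ℝ ∞ ρ₀ := β.contDiff_normed
  have hβ2 : HasCompactSupport ρ₀ := β.hasCompactSupport_normed
  have hβ3 : tsupport ρ₀ ⊆ Set.Ioo a b := by
    rw [hρ₀, β.tsupport_normed_eq]
    intro x hx
    have : |x - (a + b) / 2| ≤ (b - a) / 4 := by simpa [Real.dist_eq] using hx
    rw [abs_le] at this
    exact ⟨by linarith [this.1], by linarith [this.2]⟩
  have hβ4 : ∫ x, ρ₀ x = 1 := β.integral_normed
  set c := ∫ x in Set.Ioo a b, M x * ρ₀ x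
  refine ⟨c, ?_⟩
  have key : ∀ᵐ x, x ∈ Set.Ioo a b → M x - c = 0 := by
    refine isOpen_Ioo.ae_eq_zero_of_integral_contDiff_smul_eq_zero
      ((hMi.sub (by simp)).locallyIntegrableOn) fun ρ hρ hρc hρs => ?_
    have hi : ∀ ρ : ℝ → ℝ, tsupport ρ ⊆ Set.Ioo a b → ∀ N : ℝ → ℝ,
        ∫ x, ρ x * N x = ∫ x in Set.Ioo a b, N x * ρ x := by
      intro ρ hs N
      rw [← setIntegral_eq_integral_of_forall_compl_eq_zero (s := Set.Ioo a b)]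
      · simp_rw [mul_comm]
      · intro x hx
        rw [image_eq_zero_of_notMem_tsupport fun h => hx (hs h), zero_mul]
    have hI : ∫ x, ρ x = ∫ x in Set.Ioo a b, ρ x := by
      simpa using hi ρ hρs (fun _ => 1)
    -- Since ρ₀ has integral 1, subtracting (∫ ρ) ρ₀ leaves a test function of mean zero. Testing M
    -- with it replaces M by the constant c = ∫ M ρ₀.
    obtain ⟨χ, h1, h2, h3, h4⟩ := exists_deriv_eq_of_integral_eq_zero hab
      (σ := fun x => ρ x - (∫ t, ρ t) * ρ₀ x) (hρ.sub (contDiff_const.mul hβ1))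
      (hρc.sub (hβ2.mul_left))
      ((tsupport_sub _ _).trans (Set.union_subset hρs ((tsupport_mul_subset_right).trans hβ3)))
      (by
        rw [integral_sub (hρ.continuous.integrable_of_hasCompactSupport hρc)
          ((hβ1.continuous.integrable_of_hasCompactSupport hβ2).const_mul _),
          integral_const_mul, hβ4]; ring)
    have h5 := h χ h1 h2 h3
    rw [h4] at h5
    have h6 : ∫ x in Set.Ioo a b, M x * (ρ x - (∫ t, ρ t) * ρ₀ x) =
        (∫ x in Set.Ioo a b, M x * ρ x) - (∫ t, ρ t) * c := by
      rw [← integral_const_mul, ← integral_sub (hmul ρ hρ.continuous)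
        ((hmul ρ₀ hβ1.continuous).const_mul _)]
      congr 1; ext x; ring
    simp only [smul_eq_mul]
    rw [hi ρ hρs]
    simp only [sub_mul]
    rw [integral_sub (hmul ρ hρ.continuous)
      ((hρ.continuous.integrable_of_hasCompactSupport hρc).integrableOn.const_mul _),
      integral_const_mul, ← hI]
    linarith
  have := Measure.eqOn_open_of_ae_eq (μ := volume) (U := Set.Ioo a b) (f := M) (g := fun _ => c)
    ((ae_restrict_iff' measurableSet_Ioo).2 (key.mono fun x hx hx' => sub_eq_zero.1 (hx hx')))
    isOpen_Ioo (hM.mono Set.Ioo_subset_Icc_self) continuousOn_const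
  exact this

/-- A continuous function with an integrable weak derivative is a primitive of it. -/
theorem sub_eq_integral_of_weakDeriv {a b : ℝ} {H K : ℝ → ℝ}
    (hH : Continuous H) (hK : IntegrableOn K (Set.Ioo a b))
    (h : ∀ χ : ℝ → ℝ, ContDiff ℝ ∞ χ → HasCompactSupport χ → tsupport χ ⊆ Set.Ioo a b →
      ∫ x in Set.Ioo a b, H x * deriv χ x = -∫ x in Set.Ioo a b, K x * χ x)
    {s t : ℝ} (hs : s ∈ Set.Ioo a b) (ht : t ∈ Set.Ioo a b) :
    H t - H s = ∫ x in s..t, K x := by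
  have hab : a < b := hs.1.trans hs.2
  have hKi : IntervalIntegrable K volume a b :=
    (intervalIntegrable_iff_integrableOn_Ioo_of_le hab.le).2 hK
  have hAC := hKi.absolutelyContinuousOnInterval_intervalIntegral (c := a) (by simp)
  have hcont : ContinuousOn (fun x => ∫ v in a..x, K v) (Set.Icc a b) := by
    simpa [Set.uIcc_of_le hab.le] using hAC.continuousOn
  -- H minus the primitive of K has weak derivative zero, by integration by parts for absolutely
  -- continuous functions; the boundary terms vanish with χ.
  obtain ⟨c, hc⟩ := exists_eqOn_const_of_integral_mul_deriv_eq_zero hab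
    (M := fun x => H x - ∫ v in a..x, K v) (hH.continuousOn.sub hcont) (by
      intro χ h1 h2 h3
      have hχa : χ a = 0 := image_eq_zero_of_notMem_tsupport fun h => (h3 h).1.false
      have hχb : χ b = 0 := image_eq_zero_of_notMem_tsupport fun h => (h3 h).2.false
      have hχ' : Continuous (deriv χ) := h1.continuous_deriv (by simp)
      have hχAC : AbsolutelyContinuousOnInterval χ a b :=
        ((h1.of_le (by simp)).contDiffOn).absolutelyContinuousOnInterval
      have e1 := hAC.integral_mul_deriv_eq_deriv_mul hχAC
      have e2 : ∫ x in a..b, deriv (fun x => ∫ v in a..x, K v) x * χ x =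
          ∫ x in a..b, K x * χ x := by
        refine intervalIntegral.integral_congr_ae ?_
        filter_upwards [hKi.ae_hasDerivAt_integral] with x hx hx'
        rw [(hx (Set.uIoc_subset_uIcc hx') a (by simp)).deriv]
      have e3 : ∀ f : ℝ → ℝ, ∫ x in a..b, f x = ∫ x in Set.Ioo a b, f x := fun f => by
        rw [intervalIntegral.integral_of_le hab.le, integral_Ioc_eq_integral_Ioo]
      rw [e2, hχa, hχb, e3 (fun x => (∫ v in a..x, K v) * deriv χ x),
        e3 (fun x => K x * χ x)] at e1
      simp only [sub_mul]
      rw [integral_sub, h χ h1 h2 h3, e1]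
      · ring
      · exact ((hH.mul hχ').continuousOn.integrableOn_compact isCompact_Icc).mono_set
          Set.Ioo_subset_Icc_self
      · exact ((hcont.mul hχ'.continuousOn).integrableOn_compact isCompact_Icc).mono_set
          Set.Ioo_subset_Icc_self)
  have hsub : ∀ x ∈ Set.Ioo a b, IntervalIntegrable K volume a x := fun x hx =>
    hKi.mono_set (Set.uIcc_subset_uIcc (by simp) (by
      rw [Set.uIcc_of_le hab.le]; exact ⟨hx.1.le, hx.2.le⟩))
  have e1 := hc s hs
  have e2 := hc t ht
  rw [← intervalIntegral.integral_interval_sub_left (hsub t ht) (hsub s hs)]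
  linarith

/-! ### Absolute continuity on lines -/

theorem integrableOn_prod_iff {f : ℝ × ℝ → ℝ} {s t : Set ℝ} :
    IntegrableOn f (s ×ˢ t) ↔
      Integrable f ((volume.restrict s).prod (volume.restrict t)) := by
  rw [IntegrableOn, Measure.volume_eq_prod, Measure.prod_restrict]

theorem ae_integrableOn_section {u : ℝ × ℝ → ℝ} {s t : Set ℝ} (ht : MeasurableSet t)
    (hu : IntegrableOn u (s ×ˢ t)) :
    ∀ᵐ y, y ∈ t → IntegrableOn (fun x => u (x, y)) s := by
  have := (integrableOn_prod_iff.1 hu).prod_left_ae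
  exact (ae_restrict_iff' ht).1 this

/-- Testing a weak derivative in the direction of `x` with functions `χ(x) θ(y)`. -/
theorem integral_mul_deriv_of_weakDeriv_prod {a b c d : ℝ} {f u : ℝ × ℝ → ℝ}
    (hf : Continuous f) (hu : IntegrableOn u (Set.Ioo a b ×ˢ Set.Ioo c d))
    (h : ∀ ψ : ℝ × ℝ → ℝ, ContDiff ℝ ∞ ψ → HasCompactSupport ψ →
      tsupport ψ ⊆ Set.Ioo a b ×ˢ Set.Ioo c d →
      ∫ p in Set.Ioo a b ×ˢ Set.Ioo c d, f p * fderiv ℝ ψ p (1, 0) =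
        -∫ p in Set.Ioo a b ×ˢ Set.Ioo c d, u p * ψ p)
    {θ χ : ℝ → ℝ} (hθ : ContDiff ℝ ∞ θ) (hθc : HasCompactSupport θ)
    (hθs : tsupport θ ⊆ Set.Ioo c d) (hχ : ContDiff ℝ ∞ χ) (hχc : HasCompactSupport χ)
    (hχs : tsupport χ ⊆ Set.Ioo a b) :
    ∫ x in Set.Ioo a b, (∫ y in Set.Ioo c d, f (x, y) * θ y) * deriv χ x =
      -∫ x in Set.Ioo a b, (∫ y in Set.Ioo c d, u (x, y) * θ y) * χ x := by
  have hsupp : Function.support (fun p : ℝ × ℝ => χ p.1 * θ p.2) ⊆ tsupport χ ×ˢ tsupport θ := by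
    intro p hp
    exact ⟨subset_tsupport _ (left_ne_zero_of_mul hp), subset_tsupport _ (right_ne_zero_of_mul hp)⟩
  have hcl : tsupport (fun p : ℝ × ℝ => χ p.1 * θ p.2) ⊆ tsupport χ ×ˢ tsupport θ :=
    closure_minimal hsupp ((isClosed_tsupport _).prod (isClosed_tsupport _))
  have hχ' : Continuous (deriv χ) := hχ.continuous_deriv (by simp)
  have hfd : ∀ p : ℝ × ℝ, fderiv ℝ (fun p : ℝ × ℝ => χ p.1 * θ p.2) p (1, 0) =
      deriv χ p.1 * θ p.2 := by
    intro p
    have h1 : HasFDerivAt (fun p : ℝ × ℝ => χ p.1)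
        ((ContinuousLinearMap.toSpanSingleton ℝ (deriv χ p.1)).comp
          (ContinuousLinearMap.fst ℝ ℝ ℝ)) p :=
      ((hχ.differentiable (by simp) p.1).hasDerivAt.hasFDerivAt).comp p hasFDerivAt_fst
    have h2 : HasFDerivAt (fun p : ℝ × ℝ => θ p.2)
        ((ContinuousLinearMap.toSpanSingleton ℝ (deriv θ p.2)).comp
          (ContinuousLinearMap.snd ℝ ℝ ℝ)) p :=
      ((hθ.differentiable (by simp) p.2).hasDerivAt.hasFDerivAt).comp p hasFDerivAt_snd
    have h3 : HasFDerivAt (fun p : ℝ × ℝ => χ p.1 * θ p.2) _ p := h1.mul h2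
    rw [h3.fderiv]
    simp [mul_comm]
  have key := h (fun p => χ p.1 * θ p.2)
    ((hχ.comp contDiff_fst).mul (hθ.comp contDiff_snd))
    (HasCompactSupport.of_support_subset_isCompact (hχc.isCompact.prod hθc.isCompact) hsupp)
    (hcl.trans (Set.prod_mono hχs hθs))
  simp only [hfd] at key
  have hcpt : IsCompact (Set.Icc a b ×ˢ Set.Icc c d) := isCompact_Icc.prod isCompact_Icc
  have hsub : Set.Ioo a b ×ˢ Set.Ioo c d ⊆ Set.Icc a b ×ˢ Set.Icc c d :=
    Set.prod_mono Set.Ioo_subset_Icc_self Set.Ioo_subset_Icc_self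
  have hi1 : IntegrableOn (fun p : ℝ × ℝ => f p * (deriv χ p.1 * θ p.2))
      (Set.Ioo a b ×ˢ Set.Ioo c d) := by
    refine IntegrableOn.mono_set (Continuous.continuousOn ?_ |>.integrableOn_compact hcpt) hsub
    have := hθ.continuous
    fun_prop
  have hi2 : IntegrableOn (fun p : ℝ × ℝ => u p * (χ p.1 * θ p.2))
      (Set.Ioo a b ×ˢ Set.Ioo c d) := by
    have hcont : Continuous (fun p : ℝ × ℝ => χ p.1 * θ p.2) := by
      have := hθ.continuous
      have := hχ.continuous
      fun_prop
    obtain ⟨C, hC⟩ := hcpt.exists_bound_of_continuousOn hcont.continuousOn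
    refine Integrable.mul_bdd (c := C) hu hcont.aestronglyMeasurable ?_
    exact (ae_restrict_iff' (measurableSet_Ioo.prod measurableSet_Ioo)).2
      (Eventually.of_forall fun p hp => hC p (hsub hp))
  rw [Measure.volume_eq_prod] at key hi1 hi2
  rw [setIntegral_prod _ hi1, setIntegral_prod _ hi2] at key
  simp only [← integral_mul_const]
  convert key using 2
  · ext x; congr 1; ext y; ring
  · congr 1; ext x; congr 1; ext y; ring

/-- Averaging over y against a test function θ gives a continuous function of x with weak derivative
∫ u θ dy, to which the one-dimensional result applies. By Fubini the defect is orthogonal to every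
θ. The exceptional null set still depends on s and t. -/
theorem ae_sub_eq_integral_of_weakDeriv_prod {a b c d : ℝ} {f u : ℝ × ℝ → ℝ}
    (hf : Continuous f) (hu : IntegrableOn u (Set.Ioo a b ×ˢ Set.Ioo c d))
    (h : ∀ ψ : ℝ × ℝ → ℝ, ContDiff ℝ ∞ ψ → HasCompactSupport ψ →
      tsupport ψ ⊆ Set.Ioo a b ×ˢ Set.Ioo c d →
      ∫ p in Set.Ioo a b ×ˢ Set.Ioo c d, f p * fderiv ℝ ψ p (1, 0) =
        -∫ p in Set.Ioo a b ×ˢ Set.Ioo c d, u p * ψ p)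
    {s t : ℝ} (hs : s ∈ Set.Ioo a b) (ht : t ∈ Set.Ioo a b) :
    ∀ᵐ y, y ∈ Set.Ioo c d → f (t, y) - f (s, y) - ∫ x in s..t, u (x, y) = 0 := by
  have hst : Set.uIoc s t ⊆ Set.Ioo a b :=
    Set.uIoc_subset_uIcc.trans (Set.ordConnected_Ioo.uIcc_subset hs ht)
  have hcont : ∀ r, Continuous fun y => f (r, y) := fun r => by fun_prop
  have hcI : ∀ g : ℝ → ℝ, Continuous g → IntegrableOn g (Set.Ioo c d) := fun g hg =>
    (hg.continuousOn.integrableOn_compact isCompact_Icc).mono_set Set.Ioo_subset_Icc_self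
  have huI : IntegrableOn u (Set.uIoc s t ×ˢ Set.Ioo c d) :=
    hu.mono_set (Set.prod_mono hst subset_rfl)
  have hint : IntegrableOn (fun y => ∫ x in s..t, u (x, y)) (Set.Ioo c d) := by
    simp only [intervalIntegral.intervalIntegral_eq_integral_uIoc]
    exact (integrableOn_prod_iff.1 huI).integral_prod_right.smul (_ : ℝ)
  have hE : IntegrableOn (fun y => f (t, y) - f (s, y) - ∫ x in s..t, u (x, y)) (Set.Ioo c d) :=
    ((hcI _ (hcont t)).sub (hcI _ (hcont s))).sub hint
  refine isOpen_Ioo.ae_eq_zero_of_integral_contDiff_smul_eq_zero hE.locallyIntegrableOn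
    fun θ hθ hθc hθs => ?_
  have hθ0 : Continuous θ := hθ.continuous
  obtain ⟨C, hC⟩ := hθc.exists_bound_of_continuous hθ0
  have hbdd : ∀ g : ℝ → ℝ, IntegrableOn g (Set.Ioo c d) →
      IntegrableOn (fun y => g y * θ y) (Set.Ioo c d) := fun g hg =>
    Integrable.mul_bdd (c := C) hg hθ0.aestronglyMeasurable (Eventually.of_forall hC)
  have hH : Continuous fun x => ∫ y in Set.Ioo c d, f (x, y) * θ y := by
    have := continuous_parametric_integral_of_continuous (μ := volume)
      (f := fun x y => f (x, y) * θ y) (by unfold Function.uncurry; fun_prop)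
      (isCompact_Icc (a := c) (b := d))
    simpa only [integral_Icc_eq_integral_Ioo] using this
  have huθ : IntegrableOn (fun p : ℝ × ℝ => u p * θ p.2) (Set.Ioo a b ×ˢ Set.Ioo c d) :=
    Integrable.mul_bdd (c := C) hu
      (Continuous.aestronglyMeasurable (by fun_prop)) (Eventually.of_forall fun p => hC p.2)
  have hK : IntegrableOn (fun x => ∫ y in Set.Ioo c d, u (x, y) * θ y) (Set.Ioo a b) :=
    (integrableOn_prod_iff.1 huθ).integral_prod_left
  have e1 := sub_eq_integral_of_weakDeriv hH hK (fun χ hχ hχc hχs =>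
    integral_mul_deriv_of_weakDeriv_prod hf hu h hθ hθc hθs hχ hχc hχs) hs ht
  have e2 : ∫ x in s..t, ∫ y in Set.Ioo c d, u (x, y) * θ y =
      ∫ y in Set.Ioo c d, (∫ x in s..t, u (x, y) * θ y) :=
    intervalIntegral_integral_swap (f := fun x y => u (x, y) * θ y)
      (integrableOn_prod_iff.1 (huθ.mono_set (Set.prod_mono hst subset_rfl)))
  rw [← setIntegral_eq_integral_of_forall_compl_eq_zero (s := Set.Ioo c d)]
  · simp only [intervalIntegral.integral_mul_const] at e2
    have e3 : ∀ y, θ y • (f (t, y) - f (s, y) - ∫ x in s..t, u (x, y)) =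
        (f (t, y) * θ y - f (s, y) * θ y) - (∫ x in s..t, u (x, y)) * θ y := fun y => by
      simp only [smul_eq_mul]; ring
    simp only [e3]
    have e4 : IntegrableOn (fun y => f (t, y) * θ y - f (s, y) * θ y) (Set.Ioo c d) :=
      (hbdd _ (hcI _ (hcont t))).sub (hbdd _ (hcI _ (hcont s)))
    rw [integral_sub e4 (hbdd _ hint),
      integral_sub (hbdd _ (hcI _ (hcont t))) (hbdd _ (hcI _ (hcont s)))]
    linarith
  · intro y hy
    rw [image_eq_zero_of_notMem_tsupport fun h => hy (hθs h), zero_smul]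

/-- A continuous function with an integrable weak derivative in the direction of `x` is, on almost
every horizontal line, a primitive of it. -/
theorem ae_forall_sub_eq_integral_of_weakDeriv_prod {a b c d : ℝ} {f u : ℝ × ℝ → ℝ}
    (hf : Continuous f) (hu : IntegrableOn u (Set.Ioo a b ×ˢ Set.Ioo c d))
    (h : ∀ ψ : ℝ × ℝ → ℝ, ContDiff ℝ ∞ ψ → HasCompactSupport ψ →
      tsupport ψ ⊆ Set.Ioo a b ×ˢ Set.Ioo c d →
      ∫ p in Set.Ioo a b ×ˢ Set.Ioo c d, f p * fderiv ℝ ψ p (1, 0) =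
        -∫ p in Set.Ioo a b ×ˢ Set.Ioo c d, u p * ψ p) :
    ∀ᵐ y, y ∈ Set.Ioo c d → IntegrableOn (fun x => u (x, y)) (Set.Ioo a b) ∧
      ∀ s ∈ Set.Ioo a b, ∀ t ∈ Set.Ioo a b, f (t, y) - f (s, y) = ∫ x in s..t, u (x, y) := by
  rcases le_or_gt b a with hab | hab
  · simp [Set.Ioo_eq_empty (not_lt.2 hab)]
  set m := (a + b) / 2
  have hm : m ∈ Set.Ioo a b := ⟨by simp only [m]; linarith, by simp only [m]; linarith⟩
  -- With a fixed base point and rational endpoints only countably many null sets are discarded;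
  -- continuity in the endpoint gives all the others.
  have hq : ∀ᵐ y, ∀ q : ℚ, (q : ℝ) ∈ Set.Ioo a b → y ∈ Set.Ioo c d →
      f (q, y) - f (m, y) - ∫ x in m..(q : ℝ), u (x, y) = 0 := by
    rw [ae_all_iff]
    intro q
    by_cases hq : (q : ℝ) ∈ Set.Ioo a b
    · filter_upwards [ae_sub_eq_integral_of_weakDeriv_prod hf hu h hm hq] with y hy _ using hy
    · simp [hq]
  filter_upwards [hq, ae_integrableOn_section measurableSet_Ioo hu] with y hy hyi hyQ
  have hui := hyi hyQ
  refine ⟨hui, ?_⟩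
  have hKi : IntervalIntegrable (fun x => u (x, y)) volume a b :=
    (intervalIntegrable_iff_integrableOn_Ioo_of_le hab.le).2 hui
  have hmab : m ∈ Set.uIcc a b := by rw [Set.uIcc_of_le hab.le]; exact ⟨hm.1.le, hm.2.le⟩
  have hcont : ContinuousOn (fun x => ∫ v in m..x, u (v, y)) (Set.Ioo a b) :=
    (hKi.absolutelyContinuousOnInterval_intervalIntegral hmab).continuousOn.mono
      (by rw [Set.uIcc_of_le hab.le]; exact Set.Ioo_subset_Icc_self)
  have hEq : Set.EqOn (fun x => f (x, y) - f (m, y) - ∫ v in m..x, u (v, y)) (fun _ => 0)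
      (Set.Ioo a b) := by
    refine Set.EqOn.of_subset_closure (s := Set.Ioo a b ∩ Set.range ((↑) : ℚ → ℝ)) ?_
      (ContinuousOn.sub (by fun_prop) hcont) continuousOn_const Set.inter_subset_left
      (Dense.open_subset_closure_inter Rat.denseRange_cast isOpen_Ioo)
    rintro _ ⟨hx, q, rfl⟩
    exact hy q hx hyQ
  have hsub : ∀ x ∈ Set.Ioo a b, IntervalIntegrable (fun x => u (x, y)) volume m x := fun x hx =>
    hKi.mono_set (Set.uIcc_subset_uIcc hmab (by
      rw [Set.uIcc_of_le hab.le]; exact ⟨hx.1.le, hx.2.le⟩))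
  intro s hs t ht
  have e1 := hEq hs
  have e2 := hEq ht
  rw [← intervalIntegral.integral_interval_sub_left (hsub t ht) (hsub s hs)]
  simp only at e1 e2
  linarith

/-- The classical derivative in the direction of `x` agrees almost everywhere with the weak one. -/
theorem ae_X_eq_of_sub_eq_integral {a b c d : ℝ} {f u : ℝ × ℝ → ℝ}
    (hf : Continuous f) (hu : IntegrableOn u (Set.Ioo a b ×ˢ Set.Ioo c d))
    (h : ∀ᵐ y, y ∈ Set.Ioo c d → IntegrableOn (fun x => u (x, y)) (Set.Ioo a b) ∧
      ∀ s ∈ Set.Ioo a b, ∀ t ∈ Set.Ioo a b, f (t, y) - f (s, y) = ∫ x in s..t, u (x, y)) :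
    ∀ᵐ p ∂(volume.restrict (Set.Ioo a b ×ˢ Set.Ioo c d)), X f p = u p := by
  rcases le_or_gt b a with hab | hab
  · simp [Set.Ioo_eq_empty (not_lt.2 hab)]
  set m := (a + b) / 2
  have hm : m ∈ Set.Ioo a b := ⟨by simp only [m]; linarith, by simp only [m]; linarith⟩
  have hmab : m ∈ Set.uIcc a b := by rw [Set.uIcc_of_le hab.le]; exact ⟨hm.1.le, hm.2.le⟩
  have hXm : Measurable (X f) := by
    have := measurable_deriv_with_param (𝕜 := ℝ) (f := fun y x => f (x, y))
      (by unfold Function.uncurry; fun_prop)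
    exact this.comp measurable_swap
  have h1 : ∀ᵐ y ∂(volume.restrict (Set.Ioo c d)), ∀ᵐ x ∂(volume.restrict (Set.Ioo a b)),
      X f (x, y) = u (x, y) := by
    rw [ae_restrict_iff' measurableSet_Ioo]
    filter_upwards [h] with y hy hyQ
    obtain ⟨hui, hint⟩ := hy hyQ
    have hKi : IntervalIntegrable (fun x => u (x, y)) volume a b :=
      (intervalIntegrable_iff_integrableOn_Ioo_of_le hab.le).2 hui
    rw [ae_restrict_iff' measurableSet_Ioo]
    filter_upwards [hKi.ae_hasDerivAt_integral] with x hx hxQ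
    have hd := (hx (by rw [Set.uIcc_of_le hab.le]; exact ⟨hxQ.1.le, hxQ.2.le⟩) m hmab).add_const
      (f (m, y))
    refine HasDerivAt.deriv (hd.congr_of_eventuallyEq ?_)
    filter_upwards [isOpen_Ioo.mem_nhds hxQ] with t ht
    have := hint m hm t ht
    linarith
  -- Passing from almost all lines to almost all points requires a measurable set, hence a
  -- measurable representative of u. The coordinates are swapped so that the horizontal lines become
  -- the inner variable.
  have hu' := integrableOn_prod_iff.1 hu
  set u' := hu'.1.mk u
  have hu'm : Measurable u' := hu'.1.stronglyMeasurable_mk.measurable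
  have huu : ∀ᵐ p ∂((volume.restrict (Set.Ioo a b)).prod (volume.restrict (Set.Ioo c d))),
      u p = u' p := hu'.1.ae_eq_mk
  have huu2 : ∀ᵐ y ∂(volume.restrict (Set.Ioo c d)), ∀ᵐ x ∂(volume.restrict (Set.Ioo a b)),
      u (x, y) = u' (x, y) := by
    have := Measure.ae_ae_of_ae_prod (μ := volume.restrict (Set.Ioo c d))
      (ν := volume.restrict (Set.Ioo a b)) (p := fun q => u q.swap = u' q.swap)
      (Measure.measurePreserving_swap.quasiMeasurePreserving.ae huu)
    exact this
  have h2 : ∀ᵐ q ∂((volume.restrict (Set.Ioo c d)).prod (volume.restrict (Set.Ioo a b))),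
      X f q.swap = u' q.swap := by
    refine (Measure.ae_prod_iff_ae_ae (measurableSet_eq_fun (hXm.comp measurable_swap)
      (hu'm.comp measurable_swap))).2 ?_
    filter_upwards [h1, huu2] with y hy1 hy2
    filter_upwards [hy1, hy2] with x hx1 hx2
    exact hx1.trans hx2
  have h3 : ∀ᵐ p ∂((volume.restrict (Set.Ioo a b)).prod (volume.restrict (Set.Ioo c d))),
      X f p = u' p := by
    have := (Measure.measurePreserving_swap (μ := volume.restrict (Set.Ioo a b))
      (ν := volume.restrict (Set.Ioo c d))).quasiMeasurePreserving.ae h2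
    simpa using this
  rw [Measure.volume_eq_prod, ← Measure.prod_restrict]
  filter_upwards [h3, huu] with p hp1 hp2
  rw [hp1, hp2]

theorem fderiv_comp_swap {ψ : ℝ × ℝ → ℝ} (hψ : ContDiff ℝ ∞ ψ) (p : ℝ × ℝ) :
    fderiv ℝ (fun q : ℝ × ℝ => ψ q.swap) p (0, 1) = fderiv ℝ ψ p.swap (1, 0) := by
  have h1 : HasFDerivAt (fun q : ℝ × ℝ => q.swap)
      ((ContinuousLinearMap.snd ℝ ℝ ℝ).prod (ContinuousLinearMap.fst ℝ ℝ ℝ)) p :=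
    hasFDerivAt_snd.prodMk hasFDerivAt_fst
  have h2 : HasFDerivAt (fun q : ℝ × ℝ => ψ q.swap) _ p :=
    ((hψ.differentiable (by simp) p.swap).hasFDerivAt).comp p h1
  rw [h2.fderiv]
  simp

/-- The weak derivative in the direction of `y` becomes one in the direction of `x` after
exchanging the coordinates. -/
theorem weakDeriv_prod_swap {a b c d : ℝ} {f v : ℝ × ℝ → ℝ}
    (h : ∀ ψ : ℝ × ℝ → ℝ, ContDiff ℝ ∞ ψ → HasCompactSupport ψ →
      tsupport ψ ⊆ Set.Ioo a b ×ˢ Set.Ioo c d →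
      ∫ p in Set.Ioo a b ×ˢ Set.Ioo c d, f p * fderiv ℝ ψ p (0, 1) =
        -∫ p in Set.Ioo a b ×ˢ Set.Ioo c d, v p * ψ p)
    (ψ : ℝ × ℝ → ℝ) (hψ : ContDiff ℝ ∞ ψ) (hψc : HasCompactSupport ψ)
    (hψs : tsupport ψ ⊆ Set.Ioo c d ×ˢ Set.Ioo a b) :
    ∫ p in Set.Ioo c d ×ˢ Set.Ioo a b, f p.swap * fderiv ℝ ψ p (1, 0) =
        -∫ p in Set.Ioo c d ×ˢ Set.Ioo a b, v p.swap * ψ p := by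
  have key := h (fun q => ψ q.swap) (hψ.comp (contDiff_snd.prodMk contDiff_fst))
    (hψc.comp_homeomorph (Homeomorph.prodComm ℝ ℝ)) (by
      intro p hp
      have hp' : p.swap ∈ tsupport ψ := by
        have := tsupport_comp_subset_preimage ψ (Homeomorph.prodComm ℝ ℝ).continuous hp
        exact this
      exact ⟨(hψs hp').2, (hψs hp').1⟩)
  simp only [fderiv_comp_swap hψ] at key
  rw [Measure.volume_eq_prod] at key ⊢
  rw [← setIntegral_prod_swap (Set.Ioo a b), ← setIntegral_prod_swap (Set.Ioo a b)] at key
  simpa using key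

theorem ae_forall_sub_eq_integral_of_weakDeriv_prod_snd {a b c d : ℝ} {f v : ℝ × ℝ → ℝ}
    (hf : Continuous f) (hv : IntegrableOn v (Set.Ioo a b ×ˢ Set.Ioo c d))
    (h : ∀ ψ : ℝ × ℝ → ℝ, ContDiff ℝ ∞ ψ → HasCompactSupport ψ →
      tsupport ψ ⊆ Set.Ioo a b ×ˢ Set.Ioo c d →
      ∫ p in Set.Ioo a b ×ˢ Set.Ioo c d, f p * fderiv ℝ ψ p (0, 1) =
        -∫ p in Set.Ioo a b ×ˢ Set.Ioo c d, v p * ψ p) :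
    (∀ᵐ x, x ∈ Set.Ioo a b → IntegrableOn (fun y => v (x, y)) (Set.Ioo c d) ∧
      ∀ s ∈ Set.Ioo c d, ∀ t ∈ Set.Ioo c d, f (x, t) - f (x, s) = ∫ y in s..t, v (x, y)) ∧
    ∀ᵐ p ∂(volume.restrict (Set.Ioo a b ×ˢ Set.Ioo c d)),
      deriv (fun t => f (p.1, t)) p.2 = v p := by
  have hf' : Continuous fun p : ℝ × ℝ => f p.swap := hf.comp continuous_swap
  have hv' : IntegrableOn (fun p : ℝ × ℝ => v p.swap) (Set.Ioo c d ×ˢ Set.Ioo a b) :=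
    integrableOn_prod_iff.2 (integrableOn_prod_iff.1 hv).swap
  have h1 := ae_forall_sub_eq_integral_of_weakDeriv_prod hf' hv' (weakDeriv_prod_swap h)
  have h2 := ae_X_eq_of_sub_eq_integral hf' hv' h1
  refine ⟨h1, ?_⟩
  rw [Measure.volume_eq_prod, ← Measure.prod_restrict] at h2 ⊢
  have := (Measure.measurePreserving_swap (μ := volume.restrict (Set.Ioo a b))
      (ν := volume.restrict (Set.Ioo c d))).quasiMeasurePreserving.ae h2
  simpa [X] using this

/-! ### The chain rule -/

theorem _root_.AbsolutelyContinuousOnInterval.lipschitzOnWith_comp {F S : ℝ → ℝ} {a b : ℝ}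
    {s : Set ℝ} {K : NNReal} (hF : AbsolutelyContinuousOnInterval F a b)
    (hS : LipschitzOnWith K S s) (hs : Set.MapsTo F (Set.uIcc a b) s) :
    AbsolutelyContinuousOnInterval (fun x => S (F x)) a b := by
  rw [absolutelyContinuousOnInterval_iff] at hF ⊢
  intro ε hε
  obtain ⟨δ, hδ, H⟩ := hF (ε / (K + 1)) (by positivity)
  refine ⟨δ, hδ, fun E hE hlen => ?_⟩
  have h1 := H E hE hlen
  calc ∑ i ∈ Finset.range E.1, dist (S (F (E.2 i).1)) (S (F (E.2 i).2))
      ≤ ∑ i ∈ Finset.range E.1, (K + 1) * dist (F (E.2 i).1) (F (E.2 i).2) := by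
        refine Finset.sum_le_sum fun i hi => ?_
        have hm := hE.1 i hi
        have := hS.dist_le_mul _ (hs hm.1) _ (hs hm.2)
        nlinarith [dist_nonneg (x := F (E.2 i).1) (y := F (E.2 i).2)]
    _ = (K + 1) * ∑ i ∈ Finset.range E.1, dist (F (E.2 i).1) (F (E.2 i).2) := by
        rw [Finset.mul_sum]
    _ < (K + 1) * (ε / (K + 1)) := by gcongr
    _ = ε := by field_simp

/-- F is absolutely continuous with bounded range between s and t, and the C¹ function S is
Lipschitz on that range. So S ∘ F is absolutely continuous, and its derivative is given almost
everywhere by the classical chain rule. -/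
theorem comp_sub_comp_eq_integral {F k S S' : ℝ → ℝ} {a b : ℝ}
    (hS : ∀ x, HasDerivAt S (S' x) x) (hS' : Continuous S')
    (hk : IntegrableOn k (Set.Ioo a b))
    (hF : ∀ s ∈ Set.Ioo a b, ∀ t ∈ Set.Ioo a b, F t - F s = ∫ x in s..t, k x)
    {s t : ℝ} (hs : s ∈ Set.Ioo a b) (ht : t ∈ Set.Ioo a b) :
    S (F t) - S (F s) = ∫ x in s..t, S' (F x) * k x := by
  have hsub : Set.uIcc s t ⊆ Set.Ioo a b := Set.ordConnected_Ioo.uIcc_subset hs ht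
  have hki : IntervalIntegrable k volume s t :=
    (hk.mono_set hsub).intervalIntegrable
  have hF' : ∀ x ∈ Set.uIcc s t, F x = (∫ v in s..x, k v) + F s := fun x hx => by
    linarith [hF s hs x (hsub hx)]
  have hAC0 := hki.absolutelyContinuousOnInterval_intervalIntegral (c := s) (by simp)
  have hAC : AbsolutelyContinuousOnInterval (fun x => (∫ v in s..x, k v) + F s) s t :=
    hAC0.add (LipschitzOnWith.absolutelyContinuousOnInterval
      ((LipschitzWith.const (F s)).lipschitzOnWith (s := Set.uIcc s t)))
  obtain ⟨C, hC⟩ := hAC.exists_bound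
  have hSd : ContDiff ℝ 1 S := by
    rw [contDiff_one_iff_deriv]
    refine ⟨fun x => (hS x).differentiableAt, ?_⟩
    rwa [show deriv S = S' from funext fun x => (hS x).deriv]
  obtain ⟨K, hK⟩ := (hSd.contDiffOn (s := Set.Icc (-C) C)).exists_lipschitzOnWith (by decide)
    (convex_Icc _ _) isCompact_Icc
  have hcomp := hAC.lipschitzOnWith_comp hK fun x hx => by
    simpa [abs_le] using hC x hx
  have e1 := hcomp.integral_deriv_eq_sub
  rw [← hF' t (by simp), ← hF' s (by simp)] at e1
  rw [← e1]
  refine intervalIntegral.integral_congr_ae ?_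
  filter_upwards [hki.ae_hasDerivAt_integral] with x hx hx'
  have hxm := Set.uIoc_subset_uIcc hx'
  have hd := (hx hxm s (by simp)).add_const (F s)
  rw [HasDerivAt.deriv (f := fun x => S ((∫ v in s..x, k v) + F s)) ((hS _).comp x hd), hF' x hxm]

/-- The formula includes x = 0, so `stretch α` is C¹ on the whole line and the chain rule applies to
it without excluding the zeros of g₁. -/
theorem hasDerivAt_stretch {α : ℝ} (hα : 0 < α) (x : ℝ) :
    HasDerivAt (stretch α) (|x| ^ α) x := by
  have h1 : (0 : ℝ) < α + 1 := by linarith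
  have hpos : ∀ x : ℝ, 0 < x → HasDerivAt (stretch α) (|x| ^ α) x := by
    intro x hx
    have hd : HasDerivAt (fun x : ℝ => x ^ (α + 1) / (α + 1)) (|x| ^ α) x := by
      have := (Real.hasDerivAt_rpow_const (p := α + 1) (Or.inl hx.ne')).div_const (α + 1)
      convert! this using 1
      rw [abs_of_pos hx, add_sub_cancel_right]
      field_simp
    refine hd.congr_of_eventuallyEq ?_
    filter_upwards [lt_mem_nhds hx] with y hy
    rw [stretch, abs_of_pos hy, Real.rpow_add hy, Real.rpow_one, mul_comm]
  have hodd : ∀ x, stretch α x = -stretch α (-x) := fun x => by simp [stretch]; ring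
  rcases lt_trichotomy x 0 with hx | rfl | hx
  · have h2 := (hpos (-x) (by linarith)).scomp x (hasDerivAt_neg x)
    have h3 := h2.neg
    simp only [abs_neg, smul_eq_mul, neg_mul, one_mul, neg_neg] at h3
    exact h3.congr_of_eventuallyEq (Eventually.of_forall fun y => hodd y)
  · rw [abs_zero, Real.zero_rpow hα.ne', hasDerivAt_iff_tendsto_slope]
    have hc : Continuous fun y : ℝ => |y| ^ α / (α + 1) :=
      (continuous_abs.rpow_const fun _ => Or.inr hα.le).div_const _
    have ht : Tendsto (fun y : ℝ => |y| ^ α / (α + 1)) (𝓝[≠] 0) (𝓝 0) := by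
      have := hc.tendsto 0
      simp only [abs_zero, Real.zero_rpow hα.ne', zero_div] at this
      exact this.mono_left nhdsWithin_le_nhds
    refine ht.congr' ?_
    filter_upwards [self_mem_nhdsWithin] with y hy
    have hy : y ≠ 0 := hy
    simp only [slope_def_field, stretch]
    field_simp
    simp
  · exact hpos x hx

theorem continuous_abs_rpow {α : ℝ} (hα : 0 < α) : Continuous fun x : ℝ => |x| ^ α :=
  continuous_abs.rpow_const fun _ => Or.inr hα.le

/-! ### Derivatives on the zero set -/

/-- A zero with nonzero derivative is isolated among the zeros, and a set of reals has only
countably many points isolated from the right. -/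
theorem countable_zero_deriv_ne_zero (F : ℝ → ℝ) :
    {x | F x = 0 ∧ deriv F x ≠ 0}.Countable := by
  refine (countable_setOfPred_isolated_right_within (s := {x | F x = 0})).mono ?_
  rintro x ⟨hx, hd⟩
  refine ⟨hx, ?_⟩
  have hne := (differentiableAt_of_deriv_ne_zero hd).hasDerivAt.eventually_ne (c := 0) hd
  rw [← empty_mem_iff_bot]
  have h2 : ∀ᶠ z in 𝓝[{x | F x = 0} ∩ Set.Ioi x] x, F z ≠ 0 :=
    hne.filter_mono (nhdsWithin_mono _ fun z hz => (ne_of_gt hz.2 : z ≠ x))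
  filter_upwards [h2, self_mem_nhdsWithin] with z hz hz' using hz hz'.1

/-- Almost everywhere on the zero set of a continuous function its `x`-derivative vanishes. -/
theorem ae_X_eq_zero_of_eq_zero {f : ℝ × ℝ → ℝ} (hf : Continuous f) :
    ∀ᵐ p : ℝ × ℝ, f p = 0 → X f p = 0 := by
  have hXm : Measurable (fun q : ℝ × ℝ => X f q.swap) :=
    measurable_deriv_with_param (𝕜 := ℝ) (f := fun y x => f (x, y))
      (by unfold Function.uncurry; fun_prop)
  have hfs : Measurable (fun q : ℝ × ℝ => f q.swap) := (hf.comp continuous_swap).measurable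
  have h1 : ∀ᵐ q : ℝ × ℝ, f q.swap = 0 → X f q.swap = 0 := by
    rw [Measure.volume_eq_prod]
    have hset : MeasurableSet {q : ℝ × ℝ | f q.swap = 0 → X f q.swap = 0} := by
      simp only [imp_iff_not_or]
      exact (hfs (measurableSet_singleton 0)).compl.union (hXm (measurableSet_singleton 0))
    refine (Measure.ae_prod_iff_ae_ae hset).2 (Eventually.of_forall fun y => ?_)
    have := (countable_zero_deriv_ne_zero fun x => f (x, y)).ae_notMem volume
    filter_upwards [this] with x hx h0
    by_contra hne
    exact hx ⟨h0, hne⟩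
  rw [Measure.volume_eq_prod] at h1 ⊢
  have := (Measure.measurePreserving_swap (μ := (volume : Measure ℝ))
      (ν := (volume : Measure ℝ))).quasiMeasurePreserving.ae h1
  simpa using this

theorem ae_deriv_snd_eq_zero_of_eq_zero {f : ℝ × ℝ → ℝ} (hf : Continuous f) :
    ∀ᵐ p : ℝ × ℝ, f p = 0 → deriv (fun t => f (p.1, t)) p.2 = 0 := by
  have h1 := ae_X_eq_zero_of_eq_zero (hf.comp continuous_swap)
  rw [Measure.volume_eq_prod] at h1 ⊢
  have := (Measure.measurePreserving_swap (μ := (volume : Measure ℝ))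
      (ν := (volume : Measure ℝ))).quasiMeasurePreserving.ae h1
  simpa [X] using this

@[simp]
theorem meyerson_re {α : ℝ} (hα : 0 < α) (p : ℝ × ℝ) : (meyerson α hα p).re = stretch α p.1 := rfl

@[simp]
theorem meyerson_im {α : ℝ} (hα : 0 < α) (p : ℝ × ℝ) : (meyerson α hα p).im = p.2 := rfl

theorem stretch_add_mul_I {α : ℝ} (hα : 0 < α) (x y : ℝ) :
    (stretch α x : ℂ) + y * Complex.I = meyerson α hα (x, y) := by
  apply Complex.ext <;> simp

/-! ### Green's formula -/

/-- On almost every horizontal line of the rectangle `(a, b) × (c, d)` the function `f` is a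
primitive of the integrable function `u`. -/
def IsPrimitiveX (a b c d : ℝ) (f u : ℝ × ℝ → ℝ) : Prop :=
  IntegrableOn u (Set.Ioo a b ×ˢ Set.Ioo c d) ∧
    ∀ᵐ y, y ∈ Set.Ioo c d → IntegrableOn (fun x => u (x, y)) (Set.Ioo a b) ∧
      ∀ s ∈ Set.Ioo a b, ∀ t ∈ Set.Ioo a b, f (t, y) - f (s, y) = ∫ x in s..t, u (x, y)

/-- On almost every vertical line of the rectangle `(a, b) × (c, d)` the function `f` is a
primitive of the integrable function `v`. -/
def IsPrimitiveY (a b c d : ℝ) (f v : ℝ × ℝ → ℝ) : Prop :=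
  IntegrableOn v (Set.Ioo a b ×ˢ Set.Ioo c d) ∧
    ∀ᵐ x, x ∈ Set.Ioo a b → IntegrableOn (fun y => v (x, y)) (Set.Ioo c d) ∧
      ∀ s ∈ Set.Ioo c d, ∀ t ∈ Set.Ioo c d, f (x, t) - f (x, s) = ∫ y in s..t, v (x, y)

theorem integrableOn_continuous_mul {a b c d : ℝ} {k u : ℝ × ℝ → ℝ} (hk : Continuous k)
    (hu : IntegrableOn u (Set.Ioo a b ×ˢ Set.Ioo c d)) :
    IntegrableOn (fun p => k p * u p) (Set.Ioo a b ×ˢ Set.Ioo c d) := by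
  obtain ⟨C, hC⟩ := ((isCompact_Icc (a := a) (b := b)).prod
    (isCompact_Icc (a := c) (b := d))).exists_bound_of_continuousOn hk.continuousOn
  refine Integrable.bdd_mul (c := C) hu hk.aestronglyMeasurable ?_
  exact (ae_restrict_iff' (measurableSet_Ioo.prod measurableSet_Ioo)).2
    (Eventually.of_forall fun p hp =>
      hC p (Set.prod_mono Set.Ioo_subset_Icc_self Set.Ioo_subset_Icc_self hp))

theorem integrableOn_continuous_mul_Ioo {a b : ℝ} {k u : ℝ → ℝ} (hk : Continuous k)
    (hu : IntegrableOn u (Set.Ioo a b)) :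
    IntegrableOn (fun p => k p * u p) (Set.Ioo a b) := by
  obtain ⟨C, hC⟩ := (isCompact_Icc (a := a) (b := b)).exists_bound_of_continuousOn hk.continuousOn
  refine Integrable.bdd_mul (c := C) hu hk.aestronglyMeasurable ?_
  exact (ae_restrict_iff' measurableSet_Ioo).2
    (Eventually.of_forall fun p hp => hC p (Set.Ioo_subset_Icc_self hp))

theorem IsPrimitiveX.comp {a b c d : ℝ} {f u : ℝ × ℝ → ℝ} {S S' : ℝ → ℝ}
    (hS : ∀ x, HasDerivAt S (S' x) x) (hS' : Continuous S') (hf : Continuous f)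
    (h : IsPrimitiveX a b c d f u) :
    IsPrimitiveX a b c d (fun p => S (f p)) (fun p => S' (f p) * u p) := by
  refine ⟨integrableOn_continuous_mul (hS'.comp hf) h.1, ?_⟩
  filter_upwards [h.2] with y hy hyQ
  obtain ⟨h1, h2⟩ := hy hyQ
  refine ⟨integrableOn_continuous_mul_Ioo (k := fun x => S' (f (x, y)))
    (hS'.comp (by fun_prop)) h1, fun s hs t ht => ?_⟩
  exact comp_sub_comp_eq_integral (F := fun x => f (x, y)) hS hS' h1 h2 hs ht

theorem IsPrimitiveY.comp {a b c d : ℝ} {f v : ℝ × ℝ → ℝ} {S S' : ℝ → ℝ}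
    (hS : ∀ x, HasDerivAt S (S' x) x) (hS' : Continuous S') (hf : Continuous f)
    (h : IsPrimitiveY a b c d f v) :
    IsPrimitiveY a b c d (fun p => S (f p)) (fun p => S' (f p) * v p) := by
  refine ⟨integrableOn_continuous_mul (hS'.comp hf) h.1, ?_⟩
  filter_upwards [h.2] with x hx hxQ
  obtain ⟨h1, h2⟩ := hx hxQ
  refine ⟨integrableOn_continuous_mul_Ioo (k := fun y => S' (f (x, y)))
    (hS'.comp (by fun_prop)) h1, fun s hs t ht => ?_⟩
  exact comp_sub_comp_eq_integral (F := fun y => f (x, y)) hS hS' h1 h2 hs ht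

theorem integral_integral_congr_ae {a b c d x₁ x₂ y₁ y₂ : ℝ} {h k : ℝ × ℝ → ℝ}
    (hhk : ∀ᵐ p ∂(volume.restrict (Set.Ioo a b ×ˢ Set.Ioo c d)), h p = k p)
    (hx : Set.uIcc x₁ x₂ ⊆ Set.Ioo a b) (hy : Set.uIcc y₁ y₂ ⊆ Set.Ioo c d) :
    ∫ x in x₁..x₂, ∫ y in y₁..y₂, h (x, y) = ∫ x in x₁..x₂, ∫ y in y₁..y₂, k (x, y) := by
  rw [Measure.volume_eq_prod, ← Measure.prod_restrict] at hhk
  have h1 := Measure.ae_ae_of_ae_prod hhk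
  rw [ae_restrict_iff' measurableSet_Ioo] at h1
  refine intervalIntegral.integral_congr_ae ?_
  filter_upwards [h1] with x hx1 hx2
  have h2 := hx1 (hx (Set.uIoc_subset_uIcc hx2))
  rw [ae_restrict_iff' measurableSet_Ioo] at h2
  refine intervalIntegral.integral_congr_ae ?_
  filter_upwards [h2] with y hy1 hy2
  exact hy1 (hy (Set.uIoc_subset_uIcc hy2))

/-- Green's formula on a rectangle: each side is the same double integral, evaluated in one of the
two orders. It is used with w = |x|^α and ε = ±1, once for each Cauchy-Riemann equation. -/
theorem integral_weight_mul_sub_eq {a b c d x₁ x₂ y₁ y₂ ε : ℝ} {A Ay B Bx : ℝ × ℝ → ℝ} {w : ℝ → ℝ}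
    (hA : IsPrimitiveY a b c d A Ay) (hB : IsPrimitiveX a b c d B Bx)
    (hAB : ∀ᵐ p ∂(volume.restrict (Set.Ioo a b ×ˢ Set.Ioo c d)), w p.1 * Ay p = ε * Bx p)
    (hx₁ : x₁ ∈ Set.Ioo a b) (hx₂ : x₂ ∈ Set.Ioo a b)
    (hy₁ : y₁ ∈ Set.Ioo c d) (hy₂ : y₂ ∈ Set.Ioo c d) :
    ∫ x in x₁..x₂, w x * (A (x, y₂) - A (x, y₁)) =
      ε * ∫ y in y₁..y₂, (B (x₂, y) - B (x₁, y)) := by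
  have hx : Set.uIcc x₁ x₂ ⊆ Set.Ioo a b := Set.ordConnected_Ioo.uIcc_subset hx₁ hx₂
  have hy : Set.uIcc y₁ y₂ ⊆ Set.Ioo c d := Set.ordConnected_Ioo.uIcc_subset hy₁ hy₂
  calc ∫ x in x₁..x₂, w x * (A (x, y₂) - A (x, y₁))
      = ∫ x in x₁..x₂, ∫ y in y₁..y₂, w x * Ay (x, y) := by
        refine intervalIntegral.integral_congr_ae ?_
        filter_upwards [hA.2] with x hx1 hx2
        rw [(hx1 (hx (Set.uIoc_subset_uIcc hx2))).2 y₁ hy₁ y₂ hy₂,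
          intervalIntegral.integral_const_mul]
    _ = ∫ x in x₁..x₂, ∫ y in y₁..y₂, ε * Bx (x, y) :=
        integral_integral_congr_ae (h := fun p => w p.1 * Ay p) (k := fun p => ε * Bx p) hAB hx hy
    _ = ∫ y in y₁..y₂, ∫ x in x₁..x₂, ε * Bx (x, y) := by
        refine intervalIntegral_intervalIntegral_swap (F := fun x y => ε * Bx (x, y)) ?_
        exact IntegrableOn.mono_set (hB.1.const_mul ε) (Set.prod_mono
          (Set.uIoc_subset_uIcc.trans hx) (Set.uIoc_subset_uIcc.trans hy))
    _ = ∫ y in y₁..y₂, ε * (B (x₂, y) - B (x₁, y)) := by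
        refine intervalIntegral.integral_congr_ae ?_
        filter_upwards [hB.2] with y hy1 hy2
        rw [(hy1 (hy (Set.uIoc_subset_uIcc hy2))).2 x₁ hx₁ x₂ hx₂,
          intervalIntegral.integral_const_mul]
    _ = ε * ∫ y in y₁..y₂, (B (x₂, y) - B (x₁, y)) := by
        rw [intervalIntegral.integral_const_mul]

theorem intervalIntegral_ofReal_add_mul_I {h k : ℝ → ℝ} (hh : Continuous h) (hk : Continuous k)
    (a b : ℝ) : ∫ x in a..b, ((h x : ℂ) + (k x : ℂ) * Complex.I) =
      ((∫ x in a..b, h x : ℝ) : ℂ) + ((∫ x in a..b, k x : ℝ) : ℂ) * Complex.I := by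
  rw [intervalIntegral.integral_add, intervalIntegral.integral_mul_const,
    intervalIntegral.integral_ofReal, intervalIntegral.integral_ofReal]
  · exact (Complex.continuous_ofReal.comp hh).intervalIntegrable _ _
  · exact ((Complex.continuous_ofReal.comp hk).mul continuous_const).intervalIntegrable _ _

/-- A function on the complex plane whose pull-back by the Meyerson map satisfies the weak
Cauchy-Riemann equations is holomorphic. -/
theorem differentiableOn_of_cauchyRiemann {α : ℝ} (hα : 0 < α) {a b c d : ℝ}
    {U Ux Uy V Vx Vy : ℝ × ℝ → ℝ} (hU : Continuous U) (hV : Continuous V)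
    (hUx : IsPrimitiveX a b c d U Ux) (hUy : IsPrimitiveY a b c d U Uy)
    (hVx : IsPrimitiveX a b c d V Vx) (hVy : IsPrimitiveY a b c d V Vy)
    (h₁ : ∀ᵐ p ∂(volume.restrict (Set.Ioo a b ×ˢ Set.Ioo c d)), |p.1| ^ α * Vy p = Ux p)
    (h₂ : ∀ᵐ p ∂(volume.restrict (Set.Ioo a b ×ˢ Set.Ioo c d)), |p.1| ^ α * Uy p = -Vx p)
    {F : ℂ → ℂ}
    (hF : ∀ p ∈ Set.Ioo a b ×ˢ Set.Ioo c d, F (meyerson α hα p) = (U p : ℂ) + V p * Complex.I) :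
    DifferentiableOn ℂ F (meyerson α hα '' (Set.Ioo a b ×ˢ Set.Ioo c d)) := by
  have hopen : IsOpen (meyerson α hα '' (Set.Ioo a b ×ˢ Set.Ioo c d)) :=
    (meyerson α hα).isOpenMap _ (isOpen_Ioo.prod isOpen_Ioo)
  have hcont : ContinuousOn F (meyerson α hα '' (Set.Ioo a b ×ˢ Set.Ioo c d)) := by
    have hc : Continuous fun z => (U ((meyerson α hα).symm z) : ℂ) +
        V ((meyerson α hα).symm z) * Complex.I := by
      have := (meyerson α hα).symm.continuous
      fun_prop
    refine hc.continuousOn.congr ?_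
    rintro _ ⟨p, hp, rfl⟩
    simp [hF p hp]
  -- Morera's theorem for rectangles, which suits the Meyerson map since it takes coordinate
  -- rectangles to coordinate rectangles.
  refine (Complex.isConservativeOn_and_continuousOn_iff_isDifferentiableOn hopen).1 ⟨?_, hcont⟩
  intro z w hzw
  obtain ⟨⟨x₁, y₁⟩, ⟨hx₁, hy₁⟩, rfl⟩ := hzw (show z ∈ Complex.Rectangle z w from ⟨by simp, by simp⟩)
  obtain ⟨⟨x₂, y₂⟩, ⟨hx₂, hy₂⟩, rfl⟩ := hzw (show w ∈ Complex.Rectangle _ w from ⟨by simp, by simp⟩)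
  simp only at hx₁ hx₂ hy₁ hy₂
  rw [← add_eq_zero_iff_eq_neg, Complex.wedgeIntegral_add_wedgeIntegral_eq]
  have hx : Set.uIcc x₁ x₂ ⊆ Set.Ioo a b := Set.ordConnected_Ioo.uIcc_subset hx₁ hx₂
  have hy : Set.uIcc y₁ y₂ ⊆ Set.Ioo c d := Set.ordConnected_Ioo.uIcc_subset hy₁ hy₂
  simp only [meyerson_re, meyerson_im]
  have hw := continuous_abs_rpow hα
  -- The substitution Re z = `stretch α x` produces the weight |x|^α on the horizontal sides, the
  -- same weight as in `h₁` and `h₂`.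
  have hhor : ∀ y ∈ Set.Ioo c d,
      ∫ x in stretch α x₁..stretch α x₂, F (x + y * Complex.I) =
        ((∫ x in x₁..x₂, |x| ^ α * U (x, y) : ℝ) : ℂ) +
          ((∫ x in x₁..x₂, |x| ^ α * V (x, y) : ℝ) : ℂ) * Complex.I := by
    intro y hyQ
    rw [← intervalIntegral.integral_deriv_smul_comp' (fun x _ => hasDerivAt_stretch hα x)
      hw.continuousOn, ← intervalIntegral_ofReal_add_mul_I
        (by fun_prop) (by fun_prop)]
    · refine intervalIntegral.integral_congr fun x hx' => ?_
      simp only [Function.comp]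
      rw [stretch_add_mul_I hα, hF _ ⟨hx hx', hyQ⟩]
      simp only [Complex.real_smul, Complex.ofReal_mul]
      ring
    · refine hcont.comp (by fun_prop) ?_
      rintro _ ⟨x, hx', rfl⟩
      change (stretch α x : ℂ) + y * Complex.I ∈ _
      rw [stretch_add_mul_I hα]
      exact Set.mem_image_of_mem _ ⟨hx hx', hyQ⟩
  have hver : ∀ x ∈ Set.Ioo a b,
      ∫ y in y₁..y₂, F (stretch α x + y * Complex.I) =
        ((∫ y in y₁..y₂, U (x, y) : ℝ) : ℂ) + ((∫ y in y₁..y₂, V (x, y) : ℝ) : ℂ) * Complex.I := by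
    intro x hxQ
    rw [← intervalIntegral_ofReal_add_mul_I (by fun_prop) (by fun_prop)]
    refine intervalIntegral.integral_congr fun y hy' => ?_
    rw [stretch_add_mul_I hα, hF _ ⟨hxQ, hy hy'⟩]
  rw [hhor y₁ hy₁, hhor y₂ hy₂, hver x₁ hx₁, hver x₂ hx₂]
  -- `e1` is the imaginary part of the vanishing boundary integral, `e2` the real part.
  have e1 := integral_weight_mul_sub_eq (w := fun x => |x| ^ α) (ε := 1) hVy hUx (by simpa using h₁)
    hx₁ hx₂ hy₁ hy₂
  have e2 := integral_weight_mul_sub_eq (w := fun x => |x| ^ α) (ε := -1) hUy hVx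
    (by simpa using h₂) hx₁ hx₂ hy₁ hy₂
  have hci : ∀ (k : ℝ → ℝ) (s t : ℝ), Continuous k → IntervalIntegrable k volume s t :=
    fun k s t hk => hk.intervalIntegrable s t
  simp only [mul_sub] at e1 e2
  rw [intervalIntegral.integral_sub (hci _ _ _ (by fun_prop)) (hci _ _ _ (by fun_prop)),
    intervalIntegral.integral_sub (hci _ _ _ (by fun_prop)) (hci _ _ _ (by fun_prop))] at e1 e2
  apply Complex.ext
  · simp
    linarith
  · simp
    linarith

/-! ### Holomorphy of the conjugate map -/

section Coordinates

variable {Ω Ω' : Set (ℝ × ℝ)}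

theorem ext_apply (g : Ω ≃ₜ Ω') {p : ℝ × ℝ} (hp : p ∈ Ω) : ext g p = g ⟨p, hp⟩ :=
  Subtype.val_injective.extend_apply _ _ (⟨p, hp⟩ : Ω)

theorem continuousOn_ext (g : Ω ≃ₜ Ω') : ContinuousOn (ext g) Ω := by
  rw [continuousOn_iff_continuous_domRestrict]
  have : Ω.domRestrict (ext g) = fun p => (g p : ℝ × ℝ) := by
    funext p
    exact ext_apply g p.2
  rw [this]
  fun_prop

theorem continuousOn_comp₁ (g : Ω ≃ₜ Ω') : ContinuousOn (comp₁ g) Ω :=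
  continuous_fst.comp_continuousOn (continuousOn_ext g)

theorem continuousOn_comp₂ (g : Ω ≃ₜ Ω') : ContinuousOn (comp₂ g) Ω :=
  continuous_snd.comp_continuousOn (continuousOn_ext g)

/-- The conjugate map, extended by zero. -/
noncomputable def conjugateExt (α : ℝ) (hα : 0 < α) (g : Ω ≃ₜ Ω') : ℂ → ℂ :=
  Function.extend Subtype.val (fun z : meyerson α hα '' Ω => (conjugate α hα g z : ℂ)) 0

theorem conjugate_apply {α : ℝ} (hα : 0 < α) (g : Ω ≃ₜ Ω') (p : Ω) :
    (conjugate α hα g ⟨meyerson α hα p, Set.mem_image_of_mem _ p.2⟩ : ℂ) =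
      meyerson α hα (g p) := by
  have : ((meyerson α hα).image Ω).symm ⟨meyerson α hα p, Set.mem_image_of_mem _ p.2⟩ = p := by
    rw [Homeomorph.symm_apply_eq]
    rfl
  simp only [conjugate, Homeomorph.trans_apply]
  rw [this]
  rfl

theorem conjugateExt_meyerson {α : ℝ} (hα : 0 < α) (g : Ω ≃ₜ Ω') {p : ℝ × ℝ} (hp : p ∈ Ω) :
    conjugateExt α hα g (meyerson α hα p) = meyerson α hα (ext g p) := by
  have := Subtype.val_injective.extend_apply
    (fun z : meyerson α hα '' Ω => (conjugate α hα g z : ℂ)) 0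
    ⟨meyerson α hα p, Set.mem_image_of_mem _ hp⟩
  rw [conjugateExt, ext_apply g hp, ← conjugate_apply hα g ⟨p, hp⟩]
  exact this

end Coordinates

theorem weakDeriv_mono {U Q : Set (ℝ × ℝ)} {e : ℝ × ℝ} {f u : ℝ × ℝ → ℝ}
    (h : IsWeakDeriv U e f u) (hU : MeasurableSet U) (hQ : MeasurableSet Q) (hQU : Q ⊆ U)
    {f' : ℝ × ℝ → ℝ} (hf' : Set.EqOn f' f Q) (ψ : ℝ × ℝ → ℝ) (hψ : ContDiff ℝ ∞ ψ)
    (hψc : HasCompactSupport ψ) (hψs : tsupport ψ ⊆ Q) :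
    ∫ p in Q, f' p * fderiv ℝ ψ p e = -∫ p in Q, u p * ψ p := by
  have key := h.2.2 ψ hψ hψc (hψs.trans hQU)
  rw [setIntegral_eq_of_subset_of_forall_sdiff_eq_zero hU hQU,
    setIntegral_eq_of_subset_of_forall_sdiff_eq_zero hU hQU] at key
  · rw [← key]
    exact setIntegral_congr_fun hQ fun p hp => by simp only [hf' hp]
  · intro p hp
    rw [image_eq_zero_of_notMem_tsupport fun h => hp.2 (hψs h), mul_zero]
  · intro p hp
    have : fderiv ℝ ψ p = 0 := by
      by_contra hne
      exact hp.2 (hψs (support_fderiv_subset ℝ hne))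
    simp [this]

theorem X_congr {f f₀ : ℝ × ℝ → ℝ} {p : ℝ × ℝ} (h : f =ᶠ[𝓝 p] f₀) : X f p = X f₀ p := by
  have : Tendsto (fun t : ℝ => (t, p.2)) (𝓝 p.1) (𝓝 p) :=
    Continuous.tendsto' (by fun_prop) _ _ rfl
  exact EventuallyEq.deriv_eq (this.eventually h)

theorem deriv_snd_congr {f f₀ : ℝ × ℝ → ℝ} {p : ℝ × ℝ} (h : f =ᶠ[𝓝 p] f₀) :
    deriv (fun t => f (p.1, t)) p.2 = deriv (fun t => f₀ (p.1, t)) p.2 := by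
  have : Tendsto (fun t : ℝ => (p.1, t)) (𝓝 p.2) (𝓝 p) :=
    Continuous.tendsto' (by fun_prop) _ _ rfl
  exact EventuallyEq.deriv_eq (this.eventually h)

/-- A continuous function in the horizontal Sobolev space is absolutely continuous on lines. -/
theorem MemHW.exists_isPrimitive {α : ℝ} {q : ENNReal} {A B C D a b c d : ℝ} {f₀ : ℝ × ℝ → ℝ}
    (hf₀ : ContinuousOn f₀ (Set.Icc A B ×ˢ Set.Icc C D))
    (h : MemHW α q (Set.Ioo A B ×ˢ Set.Ioo C D) f₀)
    (hAa : A < a) (hbB : b < B) (hCc : C < c) (hdD : d < D) :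
    ∃ f u v : ℝ × ℝ → ℝ, Continuous f ∧ Set.EqOn f f₀ (Set.Ioo a b ×ˢ Set.Ioo c d) ∧
      IsPrimitiveX a b c d f u ∧ IsPrimitiveY a b c d f v ∧
      ∀ᵐ p ∂(volume.restrict (Set.Ioo a b ×ˢ Set.Ioo c d)),
        X f₀ p = u p ∧ deriv (fun t => f₀ (p.1, t)) p.2 = v p := by
  have hclosed : IsClosed (Set.Icc A B ×ˢ Set.Icc C D) := isClosed_Icc.prod isClosed_Icc
  -- Tietze extension: the results on lines are stated for functions continuous on the whole plane.
  obtain ⟨f, hf⟩ := ContinuousMap.exists_restrict_eq hclosed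
    (⟨_, continuousOn_iff_continuous_domRestrict.1 hf₀⟩ : C(Set.Icc A B ×ˢ Set.Icc C D, ℝ))
  have hfeq : ∀ p ∈ Set.Icc A B ×ˢ Set.Icc C D, f p = f₀ p := fun p hp =>
    congrArg (fun k : C(Set.Icc A B ×ˢ Set.Icc C D, ℝ) => k ⟨p, hp⟩) hf
  obtain ⟨-, u, v, hu, hv, -, -⟩ := h
  set U := Set.Ioo A B ×ˢ Set.Ioo C D with hUdef
  set Q := Set.Ioo a b ×ˢ Set.Ioo c d with hQdef
  have hU : IsOpen U := isOpen_Ioo.prod isOpen_Ioo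
  have hQ : IsOpen Q := isOpen_Ioo.prod isOpen_Ioo
  have hIccU : Set.Icc a b ×ˢ Set.Icc c d ⊆ U := Set.prod_mono
    (fun x hx => ⟨by linarith [hx.1], by linarith [hx.2]⟩)
    (fun x hx => ⟨by linarith [hx.1], by linarith [hx.2]⟩)
  have hQIcc : Q ⊆ Set.Icc a b ×ˢ Set.Icc c d :=
    Set.prod_mono Set.Ioo_subset_Icc_self Set.Ioo_subset_Icc_self
  have hQU : Q ⊆ U := hQIcc.trans hIccU
  have hEq : Set.EqOn f f₀ Q := fun p hp => hfeq p
    (Set.prod_mono Set.Ioo_subset_Icc_self Set.Ioo_subset_Icc_self (hQU hp))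
  have hcpt : IsCompact (Set.Icc a b ×ˢ Set.Icc c d) := isCompact_Icc.prod isCompact_Icc
  have hui : IntegrableOn u Q := (hu.2.1.integrableOn_compact_subset hIccU hcpt).mono_set hQIcc
  have hvi : IntegrableOn v Q := (hv.2.1.integrableOn_compact_subset hIccU hcpt).mono_set hQIcc
  have hx := ae_forall_sub_eq_integral_of_weakDeriv_prod f.continuous hui
    (weakDeriv_mono hu hU.measurableSet hQ.measurableSet hQU hEq)
  have hy := ae_forall_sub_eq_integral_of_weakDeriv_prod_snd f.continuous hvi
    (weakDeriv_mono hv hU.measurableSet hQ.measurableSet hQU hEq)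
  refine ⟨f, u, v, f.continuous, hEq, ⟨hui, hx⟩, ⟨hvi, hy.1⟩, ?_⟩
  filter_upwards [ae_X_eq_of_sub_eq_integral f.continuous hui hx, hy.2,
    ae_restrict_mem hQ.measurableSet] with p h1 h2 hp
  have hev : f =ᶠ[𝓝 p] f₀ := hEq.eventuallyEq_of_mem (hQ.mem_nhds hp)
  exact ⟨(X_congr hev).symm.trans h1, (deriv_snd_congr hev).symm.trans h2⟩

/-- Applied with G = |g₁|^α. Dividing the second row by G > 0 does not change the sign of the
determinant, so O is a rotation. -/
theorem cauchyRiemann_of_smul_orthogonal {x₁ y₁ x₂ y₂ G c : ℝ} {O : Matrix (Fin 2) (Fin 2) ℝ}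
    (hO : O ∈ Matrix.orthogonalGroup (Fin 2) ℝ) (hc : 0 < c) (hG : 0 < G)
    (h : !![x₁, y₁; x₂ / G, y₂ / G] = c • O) (hdet : 0 < (!![x₁, y₁; x₂, y₂]).det) :
    y₂ = G * x₁ ∧ G * y₁ = -x₂ := by
  have h00 : x₁ = c * O 0 0 := by simpa using congrFun (congrFun h 0) 0
  have h01 : y₁ = c * O 0 1 := by simpa using congrFun (congrFun h 0) 1
  have h10 : x₂ / G = c * O 1 0 := by simpa using congrFun (congrFun h 1) 0
  have h11 : y₂ / G = c * O 1 1 := by simpa using congrFun (congrFun h 1) 1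
  rw [div_eq_iff hG.ne'] at h10 h11
  rw [Matrix.det_fin_two_of] at hdet
  have hOO := (Matrix.mem_orthogonalGroup_iff (Fin 2) ℝ).1 hO
  have k00 := congrFun (congrFun hOO 0) 0
  have k01 := congrFun (congrFun hOO 0) 1
  have k11 := congrFun (congrFun hOO 1) 1
  simp [Matrix.mul_apply, Fin.sum_univ_two] at k00 k01 k11
  set p := O 0 0
  set q := O 0 1
  set r := O 1 0
  set s := O 1 1
  subst h00 h01
  have hd : 0 < p * s - q * r := by
    have e : c * p * y₂ - c * q * x₂ = (c * c * G) * (p * s - q * r) := by rw [h10, h11]; ring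
    rw [e] at hdet
    exact pos_of_mul_pos_right hdet (by positivity)
  have hd1 : (p * s - q * r) ^ 2 = 1 := by
    have : (p * s - q * r) ^ 2 =
      (p * p + q * q) * (r * r + s * s) - (p * r + q * s) ^ 2 := by ring
    rw [this, k00, k11, k01]; ring
  have hd2 : p * s - q * r = 1 := by nlinarith
  -- The left side is the sum of the squared entries, which is 2, minus twice the determinant, which
  -- is 1.
  have hsum : (p - s) ^ 2 + (q + r) ^ 2 = 0 := by nlinarith
  have hps : p - s = 0 := by nlinarith [sq_nonneg (p - s), sq_nonneg (q + r)]
  have hqr : q + r = 0 := by nlinarith [sq_nonneg (p - s), sq_nonneg (q + r)]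
  have hs : s = p := by linarith
  have hr : r = -q := by linarith
  rw [h10, h11, hs, hr]
  constructor <;> ring

theorem ae_fst_ne_zero : ∀ᵐ p : ℝ × ℝ, p.1 ≠ 0 := by
  have : ∀ᵐ x : ℝ, x ≠ 0 := Measure.ae_ne volume 0
  exact Measure.quasiMeasurePreserving_fst.ae this

theorem exists_rectangle {Ω : Set (ℝ × ℝ)} (hΩ : IsOpen Ω) {p : ℝ × ℝ} (hp : p ∈ Ω) :
    ∃ r > 0, Set.Icc (p.1 - 2 * r) (p.1 + 2 * r) ×ˢ Set.Icc (p.2 - 2 * r) (p.2 + 2 * r) ⊆ Ω := by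
  obtain ⟨ε, hε, h⟩ := Metric.nhds_basis_closedBall.mem_iff.1 (hΩ.mem_nhds hp)
  refine ⟨ε / 2, by positivity, ?_⟩
  rw [← Real.closedBall_eq_Icc, ← Real.closedBall_eq_Icc, closedBall_prod_same]
  rwa [show 2 * (ε / 2) = ε by ring]

/-- Holomorphy is local, so it suffices to verify the weak Cauchy-Riemann equations for `stretch α`
∘ g₁ and g₂ on a rectangle around each point. -/
theorem isBiholomorphism_conjugate {α : ℝ} (hα : 0 < α) {Ω Ω' : Set (ℝ × ℝ)} (hΩ : IsOpen Ω)
    {g : Ω ≃ₜ Ω'} (hg : IsConformal α g) (ho : IsOrientationPreserving α g) :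
    DifferentiableOn ℂ (conjugateExt α hα g) (meyerson α hα '' Ω) := by
  rintro _ ⟨p, hp, rfl⟩
  obtain ⟨r, hr, hR⟩ := exists_rectangle hΩ hp
  -- The Sobolev condition is applied on the rectangle of half-width 2r. The weak derivatives are
  -- only locally integrable there, hence integrable on the rectangle of half-width r.
  set A := p.1 - 2 * r
  set B := p.1 + 2 * r
  set C := p.2 - 2 * r
  set D := p.2 + 2 * r
  set a := p.1 - r
  set b := p.1 + r
  set c := p.2 - r
  set d := p.2 + r
  set Q := Set.Ioo a b ×ˢ Set.Ioo c d with hQdef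
  have hQ : IsOpen Q := isOpen_Ioo.prod isOpen_Ioo
  have hpQ : p ∈ Q := ⟨⟨by simp only [a]; linarith, by simp only [b]; linarith⟩,
    ⟨by simp only [c]; linarith, by simp only [d]; linarith⟩⟩
  have hUcl : closure (Set.Ioo A B ×ˢ Set.Ioo C D) ⊆ Set.Icc A B ×ˢ Set.Icc C D :=
    closure_minimal (Set.prod_mono Set.Ioo_subset_Icc_self Set.Ioo_subset_Icc_self)
      (isClosed_Icc.prod isClosed_Icc)
  have hHW := hg.memHWLoc (Set.Ioo A B ×ˢ Set.Ioo C D) (isOpen_Ioo.prod isOpen_Ioo)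
    ((isCompact_Icc.prod isCompact_Icc).of_isClosed_subset isClosed_closure hUcl)
    (hUcl.trans hR)
  have hAa : A < a := by simp only [A, a]; linarith
  have hbB : b < B := by simp only [B, b]; linarith
  have hCc : C < c := by simp only [C, c]; linarith
  have hdD : d < D := by simp only [D, d]; linarith
  have hQR : Q ⊆ Set.Icc A B ×ˢ Set.Icc C D := Set.prod_mono
    (fun x hx => ⟨by linarith [hx.1], by linarith [hx.2]⟩)
    (fun x hx => ⟨by linarith [hx.1], by linarith [hx.2]⟩)
  have hQΩ : Q ⊆ Ω := hQR.trans hR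
  obtain ⟨f₁, u₁, v₁, hf₁, hEq₁, hX₁, hY₁, hd₁⟩ :=
    hHW.1.exists_isPrimitive ((continuousOn_comp₁ g).mono hR) hAa hbB hCc hdD
  obtain ⟨f₂, u₂, v₂, hf₂, hEq₂, hX₂, hY₂, hd₂⟩ :=
    hHW.2.exists_isPrimitive ((continuousOn_comp₂ g).mono hR) hAa hbB hCc hdD
  have hcr : ∀ᵐ p ∂(volume.restrict Q), |p.1| ^ α * v₂ p = |f₁ p| ^ α * u₁ p ∧
      |p.1| ^ α * (|f₁ p| ^ α * v₁ p) = -u₂ p := by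
    filter_upwards [hd₁, hd₂, ae_restrict_mem hQ.measurableSet, ae_restrict_of_ae hg.orthogonal,
      ae_restrict_of_ae ho.2, ae_restrict_of_ae ae_fst_ne_zero,
      ae_restrict_of_ae (ae_X_eq_zero_of_eq_zero hf₁),
      ae_restrict_of_ae (ae_deriv_snd_eq_zero_of_eq_zero hf₁)]
      with z h1 h2 hzQ horth hor hz0 hz1 hz2
    have hev : f₁ =ᶠ[𝓝 z] comp₁ g := hEq₁.eventuallyEq_of_mem (hQ.mem_nhds hzQ)
    rw [X_congr hev] at hz1
    rw [deriv_snd_congr hev] at hz2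
    have hdet := (hor (hQΩ hzQ)).2
    -- At almost every zero of g₁ the first row of D_H g vanishes, which is incompatible with a
    -- positive determinant. Hence almost every point lies in R_g.
    have hne : f₁ z ≠ 0 := by
      intro h0
      rw [horizontalMatrix, Matrix.det_fin_two_of, Y, Y, hz1 h0, hz2 h0] at hdet
      simp at hdet
    rw [hEq₁ hzQ] at hne ⊢
    obtain ⟨-, k, hk, O, hO, hM⟩ := horth ⟨hQΩ hzQ, fun h => h.2.elim hz0 hne⟩
    have hG : 0 < |comp₁ g z| ^ α := Real.rpow_pos_of_pos (abs_pos.2 hne) α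
    have := cauchyRiemann_of_smul_orthogonal hO hk hG hM hdet
    rw [Y, Y, h1.1, h1.2, h2.1, h2.2] at this
    exact ⟨this.1, by rw [← this.2]; ring⟩
  have hdiff := differentiableOn_of_cauchyRiemann hα (F := conjugateExt α hα g)
    ((continuous_stretch hα).comp hf₁) hf₂
    (hX₁.comp (hasDerivAt_stretch hα) (continuous_abs_rpow hα) hf₁)
    (hY₁.comp (hasDerivAt_stretch hα) (continuous_abs_rpow hα) hf₁) hX₂ hY₂
    (hcr.mono fun z hz => hz.1) (hcr.mono fun z hz => hz.2) (by
      intro z hz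
      rw [conjugateExt_meyerson hα g (hQΩ hz), ← stretch_add_mul_I hα]
      simp only [Function.comp, hEq₁ hz, hEq₂ hz]
      rfl)
  exact (hdiff.differentiableAt (((meyerson α hα).isOpenMap _ hQ).mem_nhds
    (Set.mem_image_of_mem _ hpQ))).differentiableWithinAt

/-! ### Holomorphic homeomorphisms -/

/-- The derivative of a holomorphic homeomorphism between open sets has no zeros. -/
theorem deriv_ne_zero_of_continuousOn_inverse {U V : Set ℂ} (hU : IsOpen U) (hV : IsOpen V)
    {F G : ℂ → ℂ} (hF : DifferentiableOn ℂ F U) (hG : ContinuousOn G V) (hFV : Set.MapsTo F U V)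
    (hGU : Set.MapsTo G V U) (hGF : ∀ z ∈ U, G (F z) = z) (hFG : ∀ w ∈ V, F (G w) = w)
    {z : ℂ} (hz : z ∈ U) : deriv F z ≠ 0 := by
  intro h0
  have hFa : ∀ z ∈ U, HasDerivAt F (deriv F z) z := fun z hz =>
    (hF.differentiableAt (hU.mem_nhds hz)).hasDerivAt
  have hFV' : F z ∈ V := hFV hz
  have hGc : ∀ w ∈ V, ContinuousAt G w := fun w hw => hG.continuousAt (hV.mem_nhds hw)
  have han : AnalyticAt ℂ (deriv F) z := (hF.deriv hU).analyticAt (hU.mem_nhds hz)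
  -- Either F' vanishes identically near z, so that F is locally constant and not injective, or z is
  -- an isolated zero of F'.
  rcases han.eventually_eq_zero_or_eventually_ne_zero with h | h
  · obtain ⟨ε, hε, hball⟩ := Metric.eventually_nhds_iff_ball.1 (h.and (hU.eventually_mem hz))
    have hconst : ∀ w ∈ Metric.ball z ε, F w = F z := fun w hw =>
      (convex_ball z ε).is_const_of_fderivWithin_eq_zero (𝕜 := ℂ)
        (hF.mono fun w hw => (hball w hw).2) (fun w hw => by
          rw [fderivWithin_of_isOpen Metric.isOpen_ball hw]
          ext
          simp [(hball w hw).1]) hw (Metric.mem_ball_self hε)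
    have hmem : z + (ε / 2 : ℝ) ∈ Metric.ball z ε := by
      simp [abs_of_pos hε, hε]
    have h1 := hGF _ (hball _ hmem).2
    rw [hconst _ hmem, hGF z hz] at h1
    have : ((ε / 2 : ℝ) : ℂ) = 0 := by linear_combination -h1
    rw [Complex.ofReal_eq_zero] at this
    linarith
  · rw [eventually_nhdsWithin_iff] at h
    have h1 : ∀ᶠ w in 𝓝 (F z), G w ≠ z → deriv F (G w) ≠ 0 :=
      (hGc _ hFV').eventually (by rw [hGF z hz]; exact h)
    obtain ⟨s, hs, hsub⟩ := (h1.and (hV.eventually_mem hFV')).exists_mem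
    have hd : DifferentiableOn ℂ G (s \ {F z}) := by
      rintro w ⟨hw, hne⟩
      obtain ⟨h2, hwV⟩ := hsub w hw
      have hne' : G w ≠ z := fun h => hne (by rw [Set.mem_singleton_iff, ← h, hFG w hwV])
      exact (HasDerivAt.of_local_left_inverse (hGc w hwV) (hFa _ (hGU hwV)) (h2 hne')
        ((hV.eventually_mem hwV).mono fun y hy => hFG y hy)).differentiableAt.differentiableWithinAt
    -- The continuous inverse is holomorphic off F z, so the singularity is removable; the chain
    -- rule for G ∘ F = id then gives 0 = 1.
    have hdG : DifferentiableAt ℂ G (F z) :=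
      ((Complex.differentiableOn_compl_singleton_and_continuousAt_iff hs).1
        ⟨hd, hGc _ hFV'⟩).differentiableAt hs
    have hcomp := hdG.hasDerivAt.comp z (hFa z hz)
    have hid : HasDerivAt (G ∘ F) 1 z :=
      (hasDerivAt_id z).congr_of_eventuallyEq ((hU.eventually_mem hz).mono fun y hy => hGF y hy)
    have := hcomp.unique hid
    rw [h0, mul_zero] at this
    exact zero_ne_one this

section Coordinates

variable {Ω Ω' : Set (ℝ × ℝ)}

theorem ext_mem (g : Ω ≃ₜ Ω') {p : ℝ × ℝ} (hp : p ∈ Ω) : ext g p ∈ Ω' := by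
  rw [ext_apply g hp]
  exact (g ⟨p, hp⟩).2

theorem ext_symm_ext (g : Ω ≃ₜ Ω') {p : ℝ × ℝ} (hp : p ∈ Ω) : ext g.symm (ext g p) = p := by
  rw [ext_apply g.symm (ext_mem g hp)]
  simp [ext_apply g hp]

theorem continuousOn_conjugateExt {α : ℝ} (hα : 0 < α) (g : Ω ≃ₜ Ω') :
    ContinuousOn (conjugateExt α hα g) (meyerson α hα '' Ω) := by
  have h1 : ContinuousOn (fun z => meyerson α hα (ext g ((meyerson α hα).symm z)))
      (meyerson α hα '' Ω) := by
    refine (meyerson α hα).continuous.comp_continuousOn ((continuousOn_ext g).comp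
      (meyerson α hα).symm.continuous.continuousOn ?_)
    rintro _ ⟨p, hp, rfl⟩
    simpa using hp
  refine h1.congr ?_
  rintro _ ⟨p, hp, rfl⟩
  simp [conjugateExt_meyerson hα g hp]

theorem deriv_conjugateExt_ne_zero {α : ℝ} (hα : 0 < α) (hΩ : IsOpen Ω) (hΩ' : IsOpen Ω')
    (g : Ω ≃ₜ Ω') (hF : DifferentiableOn ℂ (conjugateExt α hα g) (meyerson α hα '' Ω))
    {p : ℝ × ℝ} (hp : p ∈ Ω) : deriv (conjugateExt α hα g) (meyerson α hα p) ≠ 0 := by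
  have hmaps : ∀ {Ω Ω' : Set (ℝ × ℝ)} (g : Ω ≃ₜ Ω'),
      Set.MapsTo (conjugateExt α hα g) (meyerson α hα '' Ω) (meyerson α hα '' Ω') := by
    rintro Ω Ω' g _ ⟨p, hp, rfl⟩
    rw [conjugateExt_meyerson hα g hp]
    exact Set.mem_image_of_mem _ (ext_mem g hp)
  have hinv : ∀ {Ω Ω' : Set (ℝ × ℝ)} (g : Ω ≃ₜ Ω'), ∀ z ∈ meyerson α hα '' Ω,
      conjugateExt α hα g.symm (conjugateExt α hα g z) = z := by
    rintro Ω Ω' g _ ⟨p, hp, rfl⟩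
    rw [conjugateExt_meyerson hα g hp, conjugateExt_meyerson hα g.symm (ext_mem g hp),
      ext_symm_ext g hp]
  exact deriv_ne_zero_of_continuousOn_inverse ((meyerson α hα).isOpenMap _ hΩ)
    ((meyerson α hα).isOpenMap _ hΩ') hF (continuousOn_conjugateExt hα g.symm) (hmaps g)
    (hmaps g.symm) (hinv g) (hinv g.symm) (Set.mem_image_of_mem _ hp)

/-! ### The partial derivatives in terms of the conjugate map -/

theorem hasDerivAt_unstretch {α : ℝ} (hα : 0 < α) {x : ℝ} (hx : x ≠ 0) :
    HasDerivAt (unstretch α) (|x| ^ α)⁻¹ (stretch α x) := by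
  refine HasDerivAt.of_local_left_inverse (continuous_unstretch hα).continuousAt ?_
    (Real.rpow_pos_of_pos (abs_pos.2 hx) α).ne' (Eventually.of_forall (stretch_unstretch hα))
  rw [unstretch_stretch hα]
  exact hasDerivAt_stretch hα x

theorem comp₁_eq {α : ℝ} (hα : 0 < α) (g : Ω ≃ₜ Ω') {p : ℝ × ℝ} (hp : p ∈ Ω) :
    comp₁ g p = unstretch α (conjugateExt α hα g (meyerson α hα p)).re := by
  rw [conjugateExt_meyerson hα g hp, meyerson_re, unstretch_stretch hα, comp₁]

theorem comp₂_eq {α : ℝ} (hα : 0 < α) (g : Ω ≃ₜ Ω') {p : ℝ × ℝ} (hp : p ∈ Ω) :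
    comp₂ g p = (conjugateExt α hα g (meyerson α hα p)).im := by
  rw [conjugateExt_meyerson hα g hp, meyerson_im, comp₂]

theorem re_conjugateExt {α : ℝ} (hα : 0 < α) (g : Ω ≃ₜ Ω') {p : ℝ × ℝ} (hp : p ∈ Ω) :
    (conjugateExt α hα g (meyerson α hα p)).re = stretch α (comp₁ g p) := by
  rw [conjugateExt_meyerson hα g hp, meyerson_re, comp₁]

theorem hasDerivAt_meyerson_fst {α : ℝ} (hα : 0 < α) (x y : ℝ) :
    HasDerivAt (fun t => meyerson α hα (t, y)) ((|x| ^ α : ℝ) : ℂ) x := by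
  simp only [← stretch_add_mul_I hα]
  exact (hasDerivAt_stretch hα x).ofReal_comp.add_const _

theorem hasDerivAt_meyerson_snd {α : ℝ} (hα : 0 < α) (x y : ℝ) :
    HasDerivAt (fun t => meyerson α hα (x, t)) Complex.I y := by
  simp only [← stretch_add_mul_I hα]
  simpa using ((hasDerivAt_id y).ofReal_comp.mul_const Complex.I).const_add (stretch α x : ℂ)

theorem hasDerivAt_re {F : ℝ → ℂ} {F' : ℂ} {x : ℝ} (h : HasDerivAt F F' x) :
    HasDerivAt (fun t => (F t).re) F'.re x :=
  Complex.reCLM.hasFDerivAt.comp_hasDerivAt x h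

theorem hasDerivAt_im {F : ℝ → ℂ} {F' : ℂ} {x : ℝ} (h : HasDerivAt F F' x) :
    HasDerivAt (fun t => (F t).im) F'.im x :=
  Complex.imCLM.hasFDerivAt.comp_hasDerivAt x h

theorem eventually_mem_fst (hΩ : IsOpen Ω) {p : ℝ × ℝ} (hp : p ∈ Ω) :
    ∀ᶠ t in 𝓝 p.1, (t, p.2) ∈ Ω := by
  have : Tendsto (fun t : ℝ => (t, p.2)) (𝓝 p.1) (𝓝 p) :=
    Continuous.tendsto' (by fun_prop) _ _ rfl
  exact this.eventually (hΩ.eventually_mem hp)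

theorem eventually_mem_snd (hΩ : IsOpen Ω) {p : ℝ × ℝ} (hp : p ∈ Ω) :
    ∀ᶠ t in 𝓝 p.2, (p.1, t) ∈ Ω := by
  have : Tendsto (fun t : ℝ => (p.1, t)) (𝓝 p.2) (𝓝 p) :=
    Continuous.tendsto' (by fun_prop) _ _ rfl
  exact this.eventually (hΩ.eventually_mem hp)

/-- The partial derivatives of g₁ pass through `unstretch`, which is not differentiable at 0, hence
`h0`. Those of g₂ need no such condition. -/
theorem hasDerivAt_comp₁_fst {α : ℝ} (hα : 0 < α) (hΩ : IsOpen Ω) (g : Ω ≃ₜ Ω') {p : ℝ × ℝ}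
    (hp : p ∈ Ω) {F' : ℂ} (hF : HasDerivAt (conjugateExt α hα g) F' (meyerson α hα p))
    (h0 : comp₁ g p ≠ 0) :
    HasDerivAt (fun t => comp₁ g (t, p.2)) (|p.1| ^ α / |comp₁ g p| ^ α * F'.re) p.1 := by
  have h1 := hasDerivAt_re (hF.comp p.1 (hasDerivAt_meyerson_fst hα p.1 p.2))
  have h2 := hasDerivAt_unstretch hα h0
  rw [← re_conjugateExt hα g hp] at h2
  have h3 := h2.comp p.1 h1
  have h4 : (|comp₁ g p| ^ α)⁻¹ * (F' * ((|p.1| ^ α : ℝ) : ℂ)).re =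
      |p.1| ^ α / |comp₁ g p| ^ α * F'.re := by
    rw [Complex.re_mul_ofReal]; ring
  rw [h4] at h3
  exact h3.congr_of_eventuallyEq ((eventually_mem_fst hΩ hp).mono fun t ht => comp₁_eq hα g ht)

theorem hasDerivAt_comp₁_snd {α : ℝ} (hα : 0 < α) (hΩ : IsOpen Ω) (g : Ω ≃ₜ Ω') {p : ℝ × ℝ}
    (hp : p ∈ Ω) {F' : ℂ} (hF : HasDerivAt (conjugateExt α hα g) F' (meyerson α hα p))
    (h0 : comp₁ g p ≠ 0) :
    HasDerivAt (fun t => comp₁ g (p.1, t)) (-F'.im / |comp₁ g p| ^ α) p.2 := by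
  have h1 := hasDerivAt_re (hF.comp p.2 (hasDerivAt_meyerson_snd hα p.1 p.2))
  have h2 := hasDerivAt_unstretch hα h0
  rw [← re_conjugateExt hα g hp] at h2
  have h3 := h2.comp p.2 h1
  have h4 : (|comp₁ g p| ^ α)⁻¹ * (F' * Complex.I).re = -F'.im / |comp₁ g p| ^ α := by
    simp; ring
  rw [h4] at h3
  exact h3.congr_of_eventuallyEq ((eventually_mem_snd hΩ hp).mono fun t ht => comp₁_eq hα g ht)

theorem hasDerivAt_comp₂_fst {α : ℝ} (hα : 0 < α) (hΩ : IsOpen Ω) (g : Ω ≃ₜ Ω') {p : ℝ × ℝ}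
    (hp : p ∈ Ω) {F' : ℂ} (hF : HasDerivAt (conjugateExt α hα g) F' (meyerson α hα p)) :
    HasDerivAt (fun t => comp₂ g (t, p.2)) (|p.1| ^ α * F'.im) p.1 := by
  have h1 := hasDerivAt_im (hF.comp p.1 (hasDerivAt_meyerson_fst hα p.1 p.2))
  rw [Complex.im_mul_ofReal, mul_comm] at h1
  exact h1.congr_of_eventuallyEq ((eventually_mem_fst hΩ hp).mono fun t ht => comp₂_eq hα g ht)

theorem hasDerivAt_comp₂_snd {α : ℝ} (hα : 0 < α) (hΩ : IsOpen Ω) (g : Ω ≃ₜ Ω') {p : ℝ × ℝ}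
    (hp : p ∈ Ω) {F' : ℂ} (hF : HasDerivAt (conjugateExt α hα g) F' (meyerson α hα p)) :
    HasDerivAt (fun t => comp₂ g (p.1, t)) F'.re p.2 := by
  have h1 := hasDerivAt_im (hF.comp p.2 (hasDerivAt_meyerson_snd hα p.1 p.2))
  rw [show (F' * Complex.I).im = F'.re by simp] at h1
  exact h1.congr_of_eventuallyEq ((eventually_mem_snd hΩ hp).mono fun t ht => comp₂_eq hα g ht)

theorem mem_partialsSet {α : ℝ} (hα : 0 < α) (hΩ : IsOpen Ω) (g : Ω ≃ₜ Ω') {p : ℝ × ℝ}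
    (hp : p ∈ Ω) {F' : ℂ} (hF : HasDerivAt (conjugateExt α hα g) F' (meyerson α hα p))
    (h0 : comp₁ g p ≠ 0) : p ∈ partialsSet g :=
  ⟨hp, ⟨(hasDerivAt_comp₁_fst hα hΩ g hp hF h0).differentiableAt,
    (hasDerivAt_comp₁_snd hα hΩ g hp hF h0).differentiableAt⟩,
    (hasDerivAt_comp₂_fst hα hΩ g hp hF).differentiableAt,
    (hasDerivAt_comp₂_snd hα hΩ g hp hF).differentiableAt⟩

/-- D_α g splits into a conformal matrix that stays regular at S_g and a scalar factor that carries
all the degeneration. Both directions of the theorem study this factor. -/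
theorem grushinMatrix_eq {α : ℝ} (hα : 0 < α) (hΩ : IsOpen Ω) (g : Ω ≃ₜ Ω') {p : ℝ × ℝ}
    (hp : p ∈ Ω) {F' : ℂ} (hF : HasDerivAt (conjugateExt α hα g) F' (meyerson α hα p))
    (h0 : comp₁ g p ≠ 0) :
    grushinMatrix α g p =
      (|p.1| ^ α / |comp₁ g p| ^ α) • !![F'.re, -F'.im; F'.im, F'.re] := by
  rw [grushinMatrix, X, X, Y, Y, (hasDerivAt_comp₁_fst hα hΩ g hp hF h0).deriv,
    (hasDerivAt_comp₁_snd hα hΩ g hp hF h0).deriv, (hasDerivAt_comp₂_fst hα hΩ g hp hF).deriv,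
    (hasDerivAt_comp₂_snd hα hΩ g hp hF).deriv]
  ext i j
  fin_cases i <;> fin_cases j <;> simp <;> ring

theorem horizontalMatrix_det_eq {α : ℝ} (hα : 0 < α) (hΩ : IsOpen Ω) (g : Ω ≃ₜ Ω') {p : ℝ × ℝ}
    (hp : p ∈ Ω) {F' : ℂ} (hF : HasDerivAt (conjugateExt α hα g) F' (meyerson α hα p))
    (h0 : comp₁ g p ≠ 0) :
    (horizontalMatrix α g p).det =
      |p.1| ^ α * |p.1| ^ α / |comp₁ g p| ^ α * (F'.re ^ 2 + F'.im ^ 2) := by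
  rw [horizontalMatrix, X, X, Y, Y, (hasDerivAt_comp₁_fst hα hΩ g hp hF h0).deriv,
    (hasDerivAt_comp₁_snd hα hΩ g hp hF h0).deriv, (hasDerivAt_comp₂_fst hα hΩ g hp hF).deriv,
    (hasDerivAt_comp₂_snd hα hΩ g hp hF).deriv, Matrix.det_fin_two_of]
  ring

end Coordinates

/-! ### The limit condition -/

/-- The real matrix of the multiplication by a complex number. -/
def mulMatrix (w : ℂ) : Matrix (Fin 2) (Fin 2) ℝ := !![w.re, -w.im; w.im, w.re]

theorem continuous_mulMatrix : Continuous mulMatrix := by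
  refine continuous_matrix fun i j => ?_
  fin_cases i <;> fin_cases j <;> simp [mulMatrix] <;> fun_prop

theorem mulMatrix_eq_zero {w : ℂ} (h : mulMatrix w = 0) : w = 0 := by
  apply Complex.ext
  · simpa [mulMatrix] using congrFun (congrFun h 0) 0
  · simpa [mulMatrix] using congrFun (congrFun h 1) 0

theorem continuousAt_deriv_conjugateExt {α : ℝ} (hα : 0 < α) {Ω Ω' : Set (ℝ × ℝ)} (hΩ : IsOpen Ω)
    {g : Ω ≃ₜ Ω'} (hF : DifferentiableOn ℂ (conjugateExt α hα g) (meyerson α hα '' Ω))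
    {p : ℝ × ℝ} (hp : p ∈ Ω) :
    ContinuousAt (fun q => deriv (conjugateExt α hα g) (meyerson α hα q)) p := by
  have hopen := (meyerson α hα).isOpenMap _ hΩ
  have h1 : ContinuousAt (deriv (conjugateExt α hα g)) (meyerson α hα p) :=
    (hF.deriv hopen).continuousOn.continuousAt (hopen.mem_nhds (Set.mem_image_of_mem _ hp))
  exact ContinuousAt.comp h1 (meyerson α hα).continuous.continuousAt

theorem hasDerivAt_conjugateExt {α : ℝ} (hα : 0 < α) {Ω Ω' : Set (ℝ × ℝ)} (hΩ : IsOpen Ω)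
    {g : Ω ≃ₜ Ω'} (hF : DifferentiableOn ℂ (conjugateExt α hα g) (meyerson α hα '' Ω))
    {p : ℝ × ℝ} (hp : p ∈ Ω) :
    HasDerivAt (conjugateExt α hα g) (deriv (conjugateExt α hα g) (meyerson α hα p))
      (meyerson α hα p) :=
  (hF.differentiableAt (((meyerson α hα).isOpenMap _ hΩ).mem_nhds
    (Set.mem_image_of_mem _ hp))).hasDerivAt

theorem comp₁_eq_zero_iff {α : ℝ} (hα : 0 < α) {Ω Ω' : Set (ℝ × ℝ)} (hΩ : IsOpen Ω)
    (hΩ' : IsOpen Ω') {g : Ω ≃ₜ Ω'} (hg : IsConformal α g)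
    (hF : DifferentiableOn ℂ (conjugateExt α hα g) (meyerson α hα '' Ω))
    {p : ℝ × ℝ} (hp : p ∈ Ω) : comp₁ g p = 0 ↔ p.1 = 0 := by
  have hne := deriv_conjugateExt_ne_zero hα hΩ hΩ' g hF hp
  by_contra hcon
  have hS : p ∈ singularSet g := ⟨hp, by tauto⟩
  obtain ⟨hbot, L, hL, hlim⟩ := hg.limit p hS
  set l := 𝓝[regularSet g ∩ partialsSet g] p
  have hl : l ≤ 𝓝 p := nhdsWithin_le_nhds
  have hJ : Tendsto (fun q => mulMatrix (deriv (conjugateExt α hα g) (meyerson α hα q))) l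
      (𝓝 (mulMatrix (deriv (conjugateExt α hα g) (meyerson α hα p)))) :=
    ((continuous_mulMatrix.continuousAt.comp (continuousAt_deriv_conjugateExt hα hΩ hF hp)).tendsto
      ).mono_left hl
  have hx : Tendsto (fun q : ℝ × ℝ => |q.1| ^ α) l (𝓝 (|p.1| ^ α)) :=
    ((continuous_abs_rpow hα).comp continuous_fst).continuousAt.tendsto.mono_left hl
  have hc : Tendsto (fun q : ℝ × ℝ => |comp₁ g q| ^ α) l (𝓝 (|comp₁ g p| ^ α)) :=
    ((continuous_abs_rpow hα).continuousAt.comp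
      ((continuousOn_comp₁ g).continuousAt (hΩ.mem_nhds hp))).tendsto.mono_left hl
  have hmem : ∀ᶠ q in l, q ∈ Ω ∧ q.1 ≠ 0 ∧ comp₁ g q ≠ 0 := by
    filter_upwards [self_mem_nhdsWithin] with q hq
    exact ⟨hq.1.1, fun h => hq.1.2 ⟨hq.1.1, Or.inl h⟩, fun h => hq.1.2 ⟨hq.1.1, Or.inr h⟩⟩
  have hz : |(0 : ℝ)| ^ α = 0 := by rw [abs_zero, Real.zero_rpow hα.ne']
  -- If x = 0 and g₁ ≠ 0, the scalar factor tends to 0 and forces L = 0. If g₁ = 0 and x ≠ 0,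
  -- multiplying by the inverse factor, which tends to 0, forces F' = 0.
  by_cases h0 : p.1 = 0
  · have h1 : comp₁ g p ≠ 0 := by tauto
    rw [h0, hz] at hx
    have hpos := Real.rpow_pos_of_pos (abs_pos.2 h1) α
    have h2 := (hx.div hc hpos.ne').smul hJ
    rw [zero_div, zero_smul] at h2
    refine hL (tendsto_nhds_unique hlim (h2.congr' ?_))
    filter_upwards [hmem] with q hq
    exact (grushinMatrix_eq hα hΩ g hq.1 (hasDerivAt_conjugateExt hα hΩ hF hq.1) hq.2.2).symm
  · have h1 : comp₁ g p = 0 := by tauto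
    rw [h1, hz] at hc
    have hpos := Real.rpow_pos_of_pos (abs_pos.2 h0) α
    have h2 := (hc.div hx hpos.ne').smul hlim
    rw [zero_div, zero_smul] at h2
    refine hne (mulMatrix_eq_zero (tendsto_nhds_unique hJ (h2.congr' ?_)))
    filter_upwards [hmem] with q hq
    rw [grushinMatrix_eq hα hΩ g hq.1 (hasDerivAt_conjugateExt hα hΩ hF hq.1) hq.2.2, smul_smul,
      Pi.div_apply, div_mul_div_cancel₀ (Real.rpow_pos_of_pos (abs_pos.2 hq.2.1) α).ne',
      div_self (Real.rpow_pos_of_pos (abs_pos.2 hq.2.2) α).ne', one_smul]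
    rfl

/-! ### Weak derivatives of functions that are differentiable off the axis -/

/-- The fundamental theorem of calculus on an interval containing the support; a countable
exceptional set is harmless because h is continuous. -/
theorem integral_eq_zero_of_hasDerivAt_off_countable {h h' : ℝ → ℝ} {s : Set ℝ}
    (hs : s.Countable) (hc : Continuous h) (hsupp : HasCompactSupport h)
    (hd : ∀ x ∉ s, HasDerivAt h (h' x) x) (hi : Integrable h') : ∫ x, h' x = 0 := by
  obtain ⟨M, hM⟩ := hsupp.isCompact.isBounded.subset_ball 0
  rw [Real.ball_eq_Ioo, zero_sub, zero_add] at hM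
  set N := max M 1
  have hN : -N ≤ N := by have := le_max_right M 1; simp only [N]; linarith
  have hMN : M ≤ N := le_max_left M 1
  have hzero : ∀ x ∉ Set.Ioo (-M) M, h x = 0 := fun x hx =>
    image_eq_zero_of_notMem_tsupport fun hx' => hx (hM hx')
  have h1 : ∫ x, h' x = ∫ x in Set.Ioc (-N) N, h' x := by
    symm
    refine setIntegral_eq_integral_of_ae_compl_eq_zero ?_
    filter_upwards [hs.ae_notMem volume] with x hx hxN
    have hx' : x ∉ tsupport h := fun hx' =>
      hxN ⟨by linarith [(hM hx').1], by linarith [(hM hx').2]⟩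
    have hev : h =ᶠ[𝓝 x] fun _ => 0 := notMem_tsupport_iff_eventuallyEq.1 hx'
    exact (hd x hx).unique ((hasDerivAt_const x (0 : ℝ)).congr_of_eventuallyEq hev)
  rw [h1, ← intervalIntegral.integral_of_le hN,
    integral_eq_of_hasDerivAt_off_countable_of_le h h' hN hs hc.continuousOn
      (fun x hx => hd x hx.2) hi.intervalIntegrable,
    hzero N (fun h => by linarith [h.2]), hzero (-N) (fun h => by linarith [h.1]), sub_zero]

theorem continuous_mul_of_tsupport_subset {Ω : Set (ℝ × ℝ)} (hΩ : IsOpen Ω) {f ψ : ℝ × ℝ → ℝ}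
    (hf : ContinuousOn f Ω) (hψ : Continuous ψ) (hs : tsupport ψ ⊆ Ω) :
    Continuous fun p => f p * ψ p := by
  rw [continuous_iff_continuousAt]
  intro p
  by_cases hp : p ∈ tsupport ψ
  · exact (hf.continuousAt (hΩ.mem_nhds (hs hp))).mul hψ.continuousAt
  · refine (continuousAt_const (y := (0 : ℝ))).congr ?_
    filter_upwards [notMem_tsupport_iff_eventuallyEq.1 hp] with q hq
    simp [hq]

/-- The product rule along the line `t ↦ γ t` for a test function vanishing outside `Ω`. -/
theorem hasDerivAt_mul_of_tsupport_subset {Ω : Set (ℝ × ℝ)} {f ψ : ℝ × ℝ → ℝ} {u' : ℝ}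
    {γ : ℝ → ℝ × ℝ} {e : ℝ × ℝ} {t : ℝ} (hγ : HasDerivAt γ e t) (hψ : ContDiff ℝ ∞ ψ)
    (hs : tsupport ψ ⊆ Ω) (hf : γ t ∈ Ω → HasDerivAt (fun τ => f (γ τ)) u' t) :
    HasDerivAt (fun τ => f (γ τ) * ψ (γ τ)) (f (γ t) * fderiv ℝ ψ (γ t) e + u' * ψ (γ t)) t := by
  have hψ' : HasDerivAt (fun τ => ψ (γ τ)) (fderiv ℝ ψ (γ t) e) t :=
    (hψ.differentiable (by simp) (γ t)).hasFDerivAt.comp_hasDerivAt t hγ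
  by_cases hp : γ t ∈ tsupport ψ
  · have := (hf (hs hp)).mul hψ'
    rw [add_comm]
    exact this
  · have h1 := notMem_tsupport_iff_eventuallyEq.1 hp
    have h2 : fderiv ℝ ψ (γ t) = 0 := by
      rw [h1.fderiv_eq]; simp
    rw [h2, h1.eq_of_nhds]
    simp only [zero_apply, Pi.zero_apply, mul_zero, add_zero]
    refine (hasDerivAt_const t (0 : ℝ)).congr_of_eventuallyEq ?_
    filter_upwards [hγ.continuousAt.eventually h1] with τ hτ
    simp [hτ]

/-- The integrand in `h` is the derivative of fψ in the direction e; its integrability is supplied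
so that Fubini can be applied. -/
theorem isWeakDeriv_of_forall_integral_eq_zero {U : Set (ℝ × ℝ)} {f u : ℝ × ℝ → ℝ} {e : ℝ × ℝ}
    (hfi : IntegrableOn f U) (hui : IntegrableOn u U)
    (h : ∀ ψ : ℝ × ℝ → ℝ, ContDiff ℝ ∞ ψ → HasCompactSupport ψ → tsupport ψ ⊆ U →
      Integrable (fun p => f p * fderiv ℝ ψ p e + u p * ψ p) →
      ∫ p, (f p * fderiv ℝ ψ p e + u p * ψ p) = 0) :
    IsWeakDeriv U e f u := by
  refine ⟨hfi.locallyIntegrableOn, hui.locallyIntegrableOn, fun ψ hψ hc hs => ?_⟩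
  have hψ0 : ∀ p ∉ U, ψ p = 0 := fun p hp => image_eq_zero_of_notMem_tsupport fun h => hp (hs h)
  have hψ1 : ∀ p ∉ U, fderiv ℝ ψ p e = 0 := fun p hp => by
    have : fderiv ℝ ψ p = 0 := by
      by_contra hne
      exact hp (hs (support_fderiv_subset ℝ hne))
    simp [this]
  have hbdd : ∀ k ρ : ℝ × ℝ → ℝ, IntegrableOn k U → Continuous ρ → HasCompactSupport ρ →
      (∀ p ∉ U, ρ p = 0) → Integrable (fun p => k p * ρ p) := by
    intro k ρ hk hρ hρc hρ0
    obtain ⟨C, hC⟩ := hρc.exists_bound_of_continuous hρ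
    have h1 : IntegrableOn (fun p => k p * ρ p) U :=
      Integrable.mul_bdd (c := C) hk hρ.aestronglyMeasurable (Eventually.of_forall hC)
    refine (integrableOn_iff_integrable_of_support_subset ?_).1 h1
    intro p hp
    by_contra hpU
    exact hp (by simp [hρ0 p hpU])
  have hψc' : Continuous fun p => fderiv ℝ ψ p e :=
    (hψ.continuous_fderiv (by simp)).clm_apply continuous_const
  have hi1 := hbdd f _ hfi hψc' (hc.fderiv_apply ℝ e) hψ1
  have hi2 := hbdd u _ hui hψ.continuous hc hψ0
  have h0 := h ψ hψ hc hs (hi1.add hi2)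
  rw [integral_add hi1 hi2] at h0
  rw [setIntegral_eq_integral_of_forall_compl_eq_zero fun p hp => by rw [hψ1 p hp, mul_zero],
    setIntegral_eq_integral_of_forall_compl_eq_zero fun p hp => by rw [hψ0 p hp, mul_zero]]
  linarith

/-- A horizontal line meets the axis in a single point, where continuity of f suffices. In the
vertical case below, the axis is one line and is discarded as a null set. -/
theorem isWeakDeriv_fst_of_hasDerivAt {U : Set (ℝ × ℝ)} (hU : IsOpen U) {f u : ℝ × ℝ → ℝ}
    (hf : ContinuousOn f U)
    (hd : ∀ p ∈ U, p.1 ≠ 0 → HasDerivAt (fun t => f (t, p.2)) (u p) p.1)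
    (hfi : IntegrableOn f U) (hui : IntegrableOn u U) : IsWeakDeriv U (1, 0) f u := by
  refine isWeakDeriv_of_forall_integral_eq_zero hfi hui fun ψ hψ hc hs hi => ?_
  rw [Measure.volume_eq_prod] at hi ⊢
  rw [integral_prod_symm _ hi]
  refine integral_eq_zero_of_ae ?_
  filter_upwards [hi.prod_left_ae] with y hy
  have hcont := continuous_mul_of_tsupport_subset hU hf hψ.continuous hs
  refine integral_eq_zero_of_hasDerivAt_off_countable (h := fun x => f (x, y) * ψ (x, y))
    (Set.countable_singleton 0) (hcont.comp (by fun_prop)) ?_ (fun x hx => ?_) hy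
  · have h1 : HasCompactSupport fun p => f p * ψ p := hc.mul_left
    refine HasCompactSupport.of_support_subset_isCompact (h1.isCompact.image continuous_fst) ?_
    intro x hx
    exact ⟨(x, y), subset_tsupport _ hx, rfl⟩
  · exact hasDerivAt_mul_of_tsupport_subset (γ := fun t => (t, y))
      ((hasDerivAt_id x).prodMk (hasDerivAt_const x y)) hψ hs fun h => hd _ h hx

theorem isWeakDeriv_snd_of_hasDerivAt {U : Set (ℝ × ℝ)} (hU : IsOpen U) {f v : ℝ × ℝ → ℝ}
    (hf : ContinuousOn f U)
    (hd : ∀ p ∈ U, p.1 ≠ 0 → HasDerivAt (fun t => f (p.1, t)) (v p) p.2)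
    (hfi : IntegrableOn f U) (hvi : IntegrableOn v U) : IsWeakDeriv U (0, 1) f v := by
  refine isWeakDeriv_of_forall_integral_eq_zero hfi hvi fun ψ hψ hc hs hi => ?_
  rw [Measure.volume_eq_prod] at hi ⊢
  rw [integral_prod _ hi]
  refine integral_eq_zero_of_ae ?_
  filter_upwards [hi.prod_right_ae, Measure.ae_ne volume (0 : ℝ)] with x hx hx0
  have hcont := continuous_mul_of_tsupport_subset hU hf hψ.continuous hs
  refine integral_eq_zero_of_hasDerivAt_off_countable (h := fun y => f (x, y) * ψ (x, y))
    Set.countable_empty (hcont.comp (by fun_prop)) ?_ (fun y _ => ?_) hx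
  · have h1 : HasCompactSupport fun p => f p * ψ p := hc.mul_left
    refine HasCompactSupport.of_support_subset_isCompact (h1.isCompact.image continuous_snd) ?_
    intro y hy
    exact ⟨(x, y), subset_tsupport _ hy, rfl⟩
  · exact hasDerivAt_mul_of_tsupport_subset (γ := fun t => (x, t))
      ((hasDerivAt_const y x).prodMk (hasDerivAt_id y)) hψ hs fun h => hd _ h hx0

theorem exists_eventually_abs_le {k : ℝ × ℝ → ℝ} {p : ℝ × ℝ} (hk : ContinuousAt k p) :
    ∃ C, ∀ᶠ q in 𝓝 p, |k q| ≤ C :=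
  ⟨|k p| + 1, (hk.abs.eventually_lt continuousAt_const (lt_add_one _)).mono fun _ hq => hq.le⟩

/-- Continuity off the null axis gives measurability, and compactness of the closure makes the local
bounds uniform. -/
theorem memLp_of_locally_bounded {Ω U : Set (ℝ × ℝ)} {u : ℝ × ℝ → ℝ}
    (hu : ContinuousOn u (Ω ∩ {p | p.1 ≠ 0}))
    (hb : ∀ p ∈ Ω, ∃ C, ∀ᶠ q in 𝓝 p, q.1 ≠ 0 → |u q| ≤ C)
    (hU : IsOpen U) (hUc : IsCompact (closure U)) (hUΩ : closure U ⊆ Ω) (q : ENNReal) :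
    MemLp u q (volume.restrict U) := by
  have hbound : ∃ C, ∀ p ∈ closure U, p.1 ≠ 0 → |u p| ≤ C := by
    refine hUc.induction_on (p := fun s => ∃ C, ∀ p ∈ s, p.1 ≠ 0 → |u p| ≤ C) ⟨0, by simp⟩ ?_ ?_ ?_
    · rintro s t hst ⟨C, hC⟩
      exact ⟨C, fun p hp => hC p (hst hp)⟩
    · rintro s t ⟨C, hC⟩ ⟨D, hD⟩
      refine ⟨max C D, fun p hp h0 => ?_⟩
      rcases hp with hp | hp
      · exact (hC p hp h0).trans (le_max_left _ _)
      · exact (hD p hp h0).trans (le_max_right _ _)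
    · intro p hp
      obtain ⟨C, hC⟩ := hb p (hUΩ hp)
      exact ⟨_, mem_nhdsWithin_of_mem_nhds hC, C, fun q hq => hq⟩
  obtain ⟨C, hC⟩ := hbound
  have hfin : IsFiniteMeasure (volume.restrict U) :=
    ⟨by
      rw [Measure.restrict_apply_univ]
      exact (measure_mono subset_closure).trans_lt hUc.measure_lt_top⟩
  have hae : (U ∩ {p : ℝ × ℝ | p.1 ≠ 0} : Set (ℝ × ℝ)) =ᵐ[volume] U := by
    filter_upwards [ae_fst_ne_zero] with p hp
    simp only [eq_iff_iff]
    exact ⟨fun h => h.1, fun h => ⟨h, hp⟩⟩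
  have hne : IsOpen {p : ℝ × ℝ | p.1 ≠ 0} := isOpen_ne_fun continuous_fst continuous_const
  refine MemLp.of_bound ?_ C ?_
  · rw [← Measure.restrict_congr_set hae]
    exact (hu.mono (Set.inter_subset_inter_left _ (subset_closure.trans hUΩ))).aestronglyMeasurable
      (hU.inter hne).measurableSet
  · filter_upwards [ae_restrict_mem hU.measurableSet, ae_restrict_of_ae ae_fst_ne_zero] with p hp h0
    exact hC p (subset_closure hp) h0

/-- A continuous function with locally bounded classical partial derivatives off the axis belongs
to all horizontal Sobolev spaces on relatively compact open sets. -/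
theorem memHW_of_locally_bounded {α : ℝ} (hα : 0 < α) {Ω U : Set (ℝ × ℝ)} {f u v : ℝ × ℝ → ℝ}
    (hΩ : IsOpen Ω)
    (hf : ContinuousOn f Ω) (hu : ContinuousOn u (Ω ∩ {p | p.1 ≠ 0}))
    (hv : ContinuousOn v (Ω ∩ {p | p.1 ≠ 0}))
    (hfu : ∀ p ∈ Ω, p.1 ≠ 0 → HasDerivAt (fun t => f (t, p.2)) (u p) p.1)
    (hfv : ∀ p ∈ Ω, p.1 ≠ 0 → HasDerivAt (fun t => f (p.1, t)) (v p) p.2)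
    (hbu : ∀ p ∈ Ω, ∃ C, ∀ᶠ q in 𝓝 p, q.1 ≠ 0 → |u q| ≤ C)
    (hbv : ∀ p ∈ Ω, ∃ C, ∀ᶠ q in 𝓝 p, q.1 ≠ 0 → |v q| ≤ C)
    (hU : IsOpen U) (hUc : IsCompact (closure U)) (hUΩ : closure U ⊆ Ω) (q : ENNReal) :
    MemHW α q U f := by
  have hUΩ' : U ⊆ Ω := subset_closure.trans hUΩ
  have hbf : ∀ p ∈ Ω, ∃ C, ∀ᶠ q in 𝓝 p, q.1 ≠ 0 → |f q| ≤ C := fun p hp => by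
    obtain ⟨C, hC⟩ := exists_eventually_abs_le (hf.continuousAt (hΩ.mem_nhds hp))
    exact ⟨C, hC.mono fun q hq _ => hq⟩
  have hfc : ContinuousOn f (Ω ∩ {p | p.1 ≠ 0}) := hf.mono Set.inter_subset_left
  have hw : Continuous fun p : ℝ × ℝ => |p.1| ^ α := (continuous_abs_rpow hα).comp continuous_fst
  have hLp := memLp_of_locally_bounded hfc hbf hU hUc hUΩ
  have huLp := memLp_of_locally_bounded hu hbu hU hUc hUΩ
  have hvLp := memLp_of_locally_bounded hv hbv hU hUc hUΩ
  refine ⟨hLp q, u, v, ?_, ?_, huLp q, ?_⟩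
  · exact isWeakDeriv_fst_of_hasDerivAt hU (hf.mono hUΩ') (fun p hp => hfu p (hUΩ' hp))
      (memLp_one_iff_integrable.1 (hLp 1)) (memLp_one_iff_integrable.1 (huLp 1))
  · exact isWeakDeriv_snd_of_hasDerivAt hU (hf.mono hUΩ') (fun p hp => hfv p (hUΩ' hp))
      (memLp_one_iff_integrable.1 (hLp 1)) (memLp_one_iff_integrable.1 (hvLp 1))
  · refine memLp_of_locally_bounded (hw.continuousOn.mul hv) (fun p hp => ?_) hU hUc hUΩ q
    obtain ⟨C, hC⟩ := hbv p hp
    obtain ⟨D, hD⟩ := exists_eventually_abs_le (hw.continuousAt (x := p))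
    refine ⟨D * C, ?_⟩
    filter_upwards [hC, hD] with z h1 h2 h0
    rw [Pi.mul_apply, abs_mul]
    exact mul_le_mul h2 (h1 h0) (abs_nonneg _) ((abs_nonneg _).trans h2)

/-! ### Behaviour of holomorphic functions near the imaginary axis -/

theorem tendsto_prod_im_mul_I {z₀ : ℂ} (h0 : z₀.re = 0) :
    Tendsto (fun z : ℂ => (z, (z.im : ℂ) * Complex.I)) (𝓝 z₀) (𝓝 (z₀, z₀)) := by
  refine Continuous.tendsto' (by fun_prop) _ _ ?_
  refine Prod.ext rfl (Complex.ext ?_ ?_) <;> simp [h0]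

theorem sub_im_mul_I (z : ℂ) : z - (z.im : ℂ) * Complex.I = z.re := by
  apply Complex.ext <;> simp

/-- Each z is compared with its projection i Im z to the axis, where Re F vanishes; their difference
is Re z. Both points move, so strict differentiability is needed. The next lemma uses the same
comparison. -/
theorem tendsto_re_div_re {F : ℂ → ℂ} {F' z₀ : ℂ} (hF : HasStrictDerivAt F F' z₀) (h0 : z₀.re = 0)
    (hax : ∀ᶠ z in 𝓝 z₀, (F ((z.im : ℂ) * Complex.I)).re = 0) :
    Tendsto (fun z => (F z).re / z.re) (𝓝[{z | z.re ≠ 0}] z₀) (𝓝 F'.re) := by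
  have h1 := (hF.hasStrictFDerivAt.isLittleO).comp_tendsto (tendsto_prod_im_mul_I h0)
  have h2 : (fun z => (F z).re - z.re * F'.re) =o[𝓝 z₀] fun z => z.re := by
    rw [Asymptotics.isLittleO_iff] at h1 ⊢
    intro c hc
    filter_upwards [h1 hc, hax] with z hz hz0
    simp only [Function.comp, sub_im_mul_I, ContinuousLinearMap.toSpanSingleton_apply,
      smul_eq_mul, Complex.norm_real] at hz
    refine le_trans ?_ hz
    have : (F z).re - z.re * F'.re =
        (F z - F ((z.im : ℂ) * Complex.I) - (z.re : ℂ) * F').re := by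
      simp [hz0]
    rw [this, Real.norm_eq_abs]
    exact Complex.abs_re_le_norm _
  have h3 := (h2.mono (nhdsWithin_le_nhds (s := {z : ℂ | z.re ≠ 0}))).tendsto_div_nhds_zero
  have h4 := h3.add_const F'.re
  rw [zero_add] at h4
  refine h4.congr' ?_
  filter_upwards [self_mem_nhdsWithin] with z hz
  have hz : z.re ≠ 0 := hz
  field_simp
  ring

theorem exists_eventually_abs_im_le {k : ℂ → ℂ} {k' z₀ : ℂ} (hk : HasStrictDerivAt k k' z₀)
    (h0 : z₀.re = 0) (hax : ∀ᶠ z in 𝓝 z₀, (k ((z.im : ℂ) * Complex.I)).im = 0) :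
    ∃ C, ∀ᶠ z in 𝓝 z₀, |(k z).im| ≤ C * |z.re| := by
  have h1 := (hk.hasStrictFDerivAt.isBigO_sub).comp_tendsto (tendsto_prod_im_mul_I h0)
  obtain ⟨C, hC⟩ := h1.bound
  refine ⟨C, ?_⟩
  filter_upwards [hC, hax] with z hz hz0
  simp only [Function.comp, sub_im_mul_I, Complex.norm_real, Real.norm_eq_abs] at hz
  refine le_trans ?_ hz
  have : (k z).im = (k z - k ((z.im : ℂ) * Complex.I)).im := by simp [hz0]
  rw [this]
  exact Complex.abs_im_le_norm _

theorem abs_stretch {α : ℝ} (hα : 0 < α) (x : ℝ) : |stretch α x| = |x| * |x| ^ α / (α + 1) := by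
  rw [stretch, abs_div, abs_mul, abs_of_nonneg (Real.rpow_nonneg (abs_nonneg x) α),
    abs_of_pos (by linarith : (0 : ℝ) < α + 1)]

theorem stretch_eq_zero_iff {α : ℝ} (hα : 0 < α) {x : ℝ} : stretch α x = 0 ↔ x = 0 := by
  constructor
  · intro h
    rw [← unstretch_stretch hα x, h]
    simp [unstretch]
  · rintro rfl
    simp [stretch]

/-- This writes the weight in the complex coordinate, so that (|x| / |g₁|)^α becomes |Re z / Re
F|^(α/(α+1)). -/
theorem abs_rpow_eq {α : ℝ} (hα : 0 < α) {x : ℝ} (hx : x ≠ 0) :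
    |x| ^ α = ((α + 1) * |stretch α x|) ^ (α / (α + 1)) := by
  have h1 : (0 : ℝ) < α + 1 := by linarith
  have hx' := abs_pos.2 hx
  have : (α + 1) * |stretch α x| = |x| ^ (α + 1) := by
    rw [abs_stretch hα, Real.rpow_add hx', Real.rpow_one]
    field_simp
  rw [this, ← Real.rpow_mul hx'.le]
  congr 1
  field_simp

/-! ### Axis-preserving biholomorphisms are Grushin-conformal -/

section Converse

variable {Ω Ω' : Set (ℝ × ℝ)} {α : ℝ}

/-- The conjugate map is holomorphic and `g` preserves the axis. -/
structure IsAxisBiholomorphic (hα : 0 < α) (g : Ω ≃ₜ Ω') : Prop where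
  differentiableOn : DifferentiableOn ℂ (conjugateExt α hα g) (meyerson α hα '' Ω)
  eq_zero_iff : ∀ p ∈ Ω, comp₁ g p = 0 ↔ p.1 = 0

namespace IsAxisBiholomorphic

theorem re_eq_zero {hα : 0 < α} {g : Ω ≃ₜ Ω'} (h : IsAxisBiholomorphic hα g) {z : ℂ}
    (hz : z ∈ meyerson α hα '' Ω) (h0 : z.re = 0) : (conjugateExt α hα g z).re = 0 := by
  obtain ⟨p, hp, rfl⟩ := hz
  rw [meyerson_re, stretch_eq_zero_iff hα] at h0
  rw [re_conjugateExt hα g hp, (h.eq_zero_iff p hp).2 h0, stretch_eq_zero_iff hα]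

/-- Along the axis F stays purely imaginary, so its derivative i F' in the vertical direction has
real part zero. -/
theorem im_deriv_eq_zero {hα : 0 < α} {g : Ω ≃ₜ Ω'} (h : IsAxisBiholomorphic hα g)
    (hΩ : IsOpen Ω) {p : ℝ × ℝ} (hp : p ∈ Ω) (h0 : p.1 = 0) :
    (deriv (conjugateExt α hα g) (meyerson α hα p)).im = 0 := by
  have h1 := hasDerivAt_re ((hasDerivAt_conjugateExt hα hΩ h.differentiableOn hp).comp p.2
    (hasDerivAt_meyerson_snd hα p.1 p.2))
  have h2 : HasDerivAt (fun t => ((conjugateExt α hα g ∘ fun t => meyerson α hα (p.1, t)) t).re)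
      0 p.2 := by
    refine (hasDerivAt_const p.2 (0 : ℝ)).congr_of_eventuallyEq ?_
    filter_upwards [eventually_mem_snd hΩ hp] with t ht
    exact h.re_eq_zero (Set.mem_image_of_mem _ ht) (by simp [h0, stretch])
  simpa using h1.unique h2

theorem eventually_im_mul_I_mem {hα : 0 < α} (hΩ : IsOpen Ω) {p : ℝ × ℝ} (hp : p ∈ Ω)
    (h0 : p.1 = 0) : ∀ᶠ z in 𝓝 (meyerson α hα p), (z.im : ℂ) * Complex.I ∈ meyerson α hα '' Ω := by
  have h1 : (meyerson α hα p).re = 0 := by simp [h0, stretch]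
  have h2 : Tendsto (fun z : ℂ => (z.im : ℂ) * Complex.I) (𝓝 (meyerson α hα p))
      (𝓝 (meyerson α hα p)) := (continuous_snd.tendsto _).comp (tendsto_prod_im_mul_I h1)
  exact h2.eventually (((meyerson α hα).isOpenMap _ hΩ).eventually_mem
    (Set.mem_image_of_mem _ hp))

/-- The ratio `(|x| / |g₁|)^α` has a positive limit at the points of the axis. -/
theorem exists_tendsto_ratio {hα : 0 < α} {g : Ω ≃ₜ Ω'} (h : IsAxisBiholomorphic hα g)
    (hΩ : IsOpen Ω) (hΩ' : IsOpen Ω') {p : ℝ × ℝ} (hp : p ∈ Ω) (h0 : p.1 = 0) :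
    ∃ c > 0, Tendsto (fun q : ℝ × ℝ => |q.1| ^ α / |comp₁ g q| ^ α)
      (𝓝[{q | q.1 ≠ 0}] p) (𝓝 c) := by
  set F := conjugateExt α hα g with hFdef
  have hopen := (meyerson α hα).isOpenMap _ hΩ
  have hz0 : (meyerson α hα p).re = 0 := by simp [h0, stretch]
  have hmem : meyerson α hα p ∈ meyerson α hα '' Ω := Set.mem_image_of_mem _ hp
  have hstrict : HasStrictDerivAt F (deriv F (meyerson α hα p)) (meyerson α hα p) :=
    (h.differentiableOn.analyticAt (hopen.mem_nhds hmem)).hasStrictDerivAt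
  have hre : (deriv F (meyerson α hα p)).re ≠ 0 := fun hre =>
    deriv_conjugateExt_ne_zero hα hΩ hΩ' g h.differentiableOn hp
      (Complex.ext hre (h.im_deriv_eq_zero hΩ hp h0))
  have h1 := tendsto_re_div_re hstrict hz0
    ((eventually_im_mul_I_mem hΩ hp h0).mono fun z hz => h.re_eq_zero hz (by simp))
  have h2 : Tendsto (meyerson α hα) (𝓝[{q | q.1 ≠ 0}] p)
      (𝓝[{z | z.re ≠ 0}] (meyerson α hα p)) := by
    refine ((meyerson α hα).continuous.continuousAt.tendsto).inf (tendsto_principal_principal.2 ?_)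
    intro q hq
    simpa [stretch_eq_zero_iff hα] using hq
  -- The limit is |Re F'|^(-α/(α+1)), with F' real and nonzero on the axis.
  have h3 := (((h1.comp h2).inv₀ hre).abs).rpow_const (p := α / (α + 1))
    (Or.inl (abs_pos.2 (inv_ne_zero hre)).ne')
  refine ⟨_, Real.rpow_pos_of_pos (abs_pos.2 (inv_ne_zero hre)) _, h3.congr' ?_⟩
  filter_upwards [self_mem_nhdsWithin, mem_nhdsWithin_of_mem_nhds (hΩ.mem_nhds hp)] with q hq hqΩ
  have hq : q.1 ≠ 0 := hq
  have hc : comp₁ g q ≠ 0 := fun hc => hq ((h.eq_zero_iff q hqΩ).1 hc)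
  have hα1 : (0 : ℝ) < α + 1 := by linarith
  simp only [Function.comp]
  rw [abs_rpow_eq hα hq, abs_rpow_eq hα hc, ← Real.div_rpow (by positivity) (by positivity),
    re_conjugateExt hα g hqΩ, meyerson_re, inv_div, abs_div, mul_div_mul_left _ _ hα1.ne']

theorem exists_eventually_ratio_le {hα : 0 < α} {g : Ω ≃ₜ Ω'} (h : IsAxisBiholomorphic hα g)
    (hΩ : IsOpen Ω) (hΩ' : IsOpen Ω') {p : ℝ × ℝ} (hp : p ∈ Ω) :
    ∃ C, ∀ᶠ q in 𝓝 p, q.1 ≠ 0 → |q.1| ^ α / |comp₁ g q| ^ α ≤ C := by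
  by_cases h0 : p.1 = 0
  · obtain ⟨c, -, hc⟩ := h.exists_tendsto_ratio hΩ hΩ' hp h0
    have := hc.eventually_lt_const (lt_add_one c)
    rw [eventually_nhdsWithin_iff] at this
    exact ⟨c + 1, this.mono fun q hq hq0 => (hq hq0).le⟩
  · have hc : comp₁ g p ≠ 0 := fun hc => h0 ((h.eq_zero_iff p hp).1 hc)
    have hcont : ContinuousAt (fun q : ℝ × ℝ => |q.1| ^ α / |comp₁ g q| ^ α) p :=
      ((continuous_abs_rpow hα).comp continuous_fst).continuousAt.div
        ((continuous_abs_rpow hα).continuousAt.comp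
          ((continuousOn_comp₁ g).continuousAt (hΩ.mem_nhds hp)))
        (Real.rpow_pos_of_pos (abs_pos.2 hc) α).ne'
    obtain ⟨C, hC⟩ := exists_eventually_abs_le hcont
    exact ⟨C, hC.mono fun q hq _ => (le_abs_self _).trans hq⟩

/-- Near the axis |Im F'| ≤ C |Re z| = C |x|^(α+1) / (α+1), so a factor |x| is left after dividing
by the weight. -/
theorem exists_eventually_abs_im_deriv_le {hα : 0 < α} {g : Ω ≃ₜ Ω'}
    (h : IsAxisBiholomorphic hα g) (hΩ : IsOpen Ω) {p : ℝ × ℝ} (hp : p ∈ Ω) :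
    ∃ C, ∀ᶠ q in 𝓝 p, q.1 ≠ 0 →
      |(deriv (conjugateExt α hα g) (meyerson α hα q)).im| / |q.1| ^ α ≤ C := by
  have hα1 : (0 : ℝ) < α + 1 := by linarith
  by_cases h0 : p.1 = 0
  · have hopen := (meyerson α hα).isOpenMap _ hΩ
    have hz0 : (meyerson α hα p).re = 0 := by simp [h0, stretch]
    have hstrict := ((h.differentiableOn.deriv hopen).analyticAt
      (hopen.mem_nhds (Set.mem_image_of_mem _ hp))).hasStrictDerivAt
    obtain ⟨C, hC⟩ := exists_eventually_abs_im_le hstrict hz0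
      ((eventually_im_mul_I_mem hΩ hp h0).mono fun z hz => by
        obtain ⟨q, hq, hqz⟩ := hz
        rw [← hqz]
        refine h.im_deriv_eq_zero hΩ hq ?_
        rw [← stretch_eq_zero_iff hα, ← meyerson_re hα, hqz]
        simp)
    have hC' := (meyerson α hα).continuous.continuousAt.eventually hC
    obtain ⟨D, hD⟩ := exists_eventually_abs_le (continuous_fst.continuousAt (x := p))
    refine ⟨|C| * D / (α + 1), ?_⟩
    filter_upwards [hC', hD] with q hq hqD hq0
    have hpos := Real.rpow_pos_of_pos (abs_pos.2 hq0) α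
    rw [div_le_iff₀ hpos]
    rw [meyerson_re, abs_stretch hα] at hq
    calc _ ≤ C * (|q.1| * |q.1| ^ α / (α + 1)) := hq
      _ ≤ |C| * (D * |q.1| ^ α / (α + 1)) := by
        gcongr
        exact le_abs_self C
      _ = |C| * D / (α + 1) * |q.1| ^ α := by ring
  · have hcont : ContinuousAt (fun q : ℝ × ℝ =>
        |(deriv (conjugateExt α hα g) (meyerson α hα q)).im| / |q.1| ^ α) p :=
      ((Complex.continuous_im.continuousAt.comp
        (continuousAt_deriv_conjugateExt hα hΩ h.differentiableOn hp)).abs).div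
        ((continuous_abs_rpow hα).comp continuous_fst).continuousAt
        (Real.rpow_pos_of_pos (abs_pos.2 h0) α).ne'
    obtain ⟨C, hC⟩ := exists_eventually_abs_le hcont
    exact ⟨C, hC.mono fun q hq _ => (le_abs_self _).trans hq⟩

end IsAxisBiholomorphic

end Converse

theorem exists_smul_orthogonal {w : ℂ} (hw : w ≠ 0) {r : ℝ} (hr : 0 < r) :
    ∃ c : ℝ, 0 < c ∧ ∃ O ∈ Matrix.orthogonalGroup (Fin 2) ℝ, r • mulMatrix w = c • O := by
  have hn : 0 < ‖w‖ := norm_pos_iff.2 hw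
  refine ⟨r * ‖w‖, by positivity, ‖w‖⁻¹ • mulMatrix w, ?_, ?_⟩
  · rw [Matrix.mem_orthogonalGroup_iff]
    have hsq : w.re * w.re + w.im * w.im = ‖w‖ * ‖w‖ := by
      rw [← Complex.normSq_apply, Complex.normSq_eq_norm_sq, sq]
    have h1 : ‖w‖⁻¹ * ‖w‖⁻¹ * (w.re * w.re + w.im * w.im) = 1 := by
      rw [hsq]; field_simp
    ext i j
    fin_cases i <;> fin_cases j <;>
      simp [mulMatrix, Matrix.mul_apply, Fin.sum_univ_two] <;> linarith
  · rw [smul_smul, mul_assoc, mul_inv_cancel₀ hn.ne', mul_one]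

section Converse

variable {Ω Ω' : Set (ℝ × ℝ)} {α : ℝ}

namespace IsAxisBiholomorphic

theorem comp₁_ne_zero {hα : 0 < α} {g : Ω ≃ₜ Ω'} (h : IsAxisBiholomorphic hα g) {p : ℝ × ℝ}
    (hp : p ∈ Ω) (h0 : p.1 ≠ 0) : comp₁ g p ≠ 0 := fun hc => h0 ((h.eq_zero_iff p hp).1 hc)

/-- The delicate derivative is ∂_y g₁ = -Im F' / |g₁|^α. It is bounded, up to sign, as the product
of (|x| / |g₁|)^α and Im F' / |x|^α. -/
theorem memHWLoc {hα : 0 < α} {g : Ω ≃ₜ Ω'} (h : IsAxisBiholomorphic hα g)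
    (hΩ : IsOpen Ω) (hΩ' : IsOpen Ω') (r : ENNReal) : MemHWLoc α r g := by
  intro U hU hUc hUΩ
  set D : ℝ × ℝ → ℂ := fun q => deriv (conjugateExt α hα g) (meyerson α hα q) with hDdef
  have hD : ∀ p ∈ Ω, ContinuousAt D p := fun p hp =>
    continuousAt_deriv_conjugateExt hα hΩ h.differentiableOn hp
  have hd : ∀ p ∈ Ω, HasDerivAt (conjugateExt α hα g) (D p) (meyerson α hα p) := fun p hp =>
    hasDerivAt_conjugateExt hα hΩ h.differentiableOn hp
  have hre : ∀ p ∈ Ω, ContinuousAt (fun q => (D q).re) p := fun p hp =>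
    Complex.continuous_re.continuousAt.comp (hD p hp)
  have him : ∀ p ∈ Ω, ContinuousAt (fun q => (D q).im) p := fun p hp =>
    Complex.continuous_im.continuousAt.comp (hD p hp)
  have hw : Continuous fun p : ℝ × ℝ => |p.1| ^ α := (continuous_abs_rpow hα).comp continuous_fst
  have hc : ∀ p ∈ Ω, ContinuousAt (fun q => |comp₁ g q| ^ α) p := fun p hp =>
    (continuous_abs_rpow hα).continuousAt.comp ((continuousOn_comp₁ g).continuousAt
      (hΩ.mem_nhds hp))
  have hcpos : ∀ p ∈ Ω, p.1 ≠ 0 → 0 < |comp₁ g p| ^ α := fun p hp h0 =>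
    Real.rpow_pos_of_pos (abs_pos.2 (h.comp₁_ne_zero hp h0)) α
  constructor
  · refine memHW_of_locally_bounded hα hΩ (continuousOn_comp₁ g)
      (u := fun p => |p.1| ^ α / |comp₁ g p| ^ α * (D p).re)
      (v := fun p => -(D p).im / |comp₁ g p| ^ α) ?_ ?_
      (fun p hp h0 => hasDerivAt_comp₁_fst hα hΩ g hp (hd p hp) (h.comp₁_ne_zero hp h0))
      (fun p hp h0 => hasDerivAt_comp₁_snd hα hΩ g hp (hd p hp) (h.comp₁_ne_zero hp h0))
      ?_ ?_ hU hUc hUΩ r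
    · rintro p ⟨hp, h0⟩
      exact ((hw.continuousAt.div (hc p hp) (hcpos p hp h0).ne').mul
        (hre p hp)).continuousWithinAt
    · rintro p ⟨hp, h0⟩
      exact ((him p hp).neg.div (hc p hp) (hcpos p hp h0).ne').continuousWithinAt
    · intro p hp
      obtain ⟨C₁, h₁⟩ := h.exists_eventually_ratio_le hΩ hΩ' hp
      obtain ⟨C₂, h₂⟩ := exists_eventually_abs_le (hre p hp)
      refine ⟨C₁ * C₂, ?_⟩
      filter_upwards [h₁, h₂] with q hq₁ hq₂ h0
      have hnn : 0 ≤ |q.1| ^ α / |comp₁ g q| ^ α := by positivity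
      rw [abs_mul, abs_of_nonneg hnn]
      exact mul_le_mul (hq₁ h0) hq₂ (abs_nonneg _) (hnn.trans (hq₁ h0))
    · intro p hp
      obtain ⟨C₁, h₁⟩ := h.exists_eventually_ratio_le hΩ hΩ' hp
      obtain ⟨C₂, h₂⟩ := h.exists_eventually_abs_im_deriv_le hΩ hp
      refine ⟨C₁ * C₂, ?_⟩
      filter_upwards [h₁, h₂, hΩ.mem_nhds hp] with q hq₁ hq₂ hqΩ h0
      have hnn : 0 ≤ |q.1| ^ α / |comp₁ g q| ^ α := by positivity
      have hpos := Real.rpow_pos_of_pos (abs_pos.2 h0) α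
      have hpos' := hcpos q hqΩ h0
      calc |-(D q).im / |comp₁ g q| ^ α|
          = |q.1| ^ α / |comp₁ g q| ^ α * (|(D q).im| / |q.1| ^ α) := by
            rw [abs_div, abs_neg, abs_of_pos hpos']
            field_simp
        _ ≤ C₁ * C₂ := mul_le_mul (hq₁ h0) (hq₂ h0) (by positivity) (hnn.trans (hq₁ h0))
  · have hu : ∀ p ∈ Ω, ContinuousAt (fun p : ℝ × ℝ => |p.1| ^ α * (D p).im) p := fun p hp =>
      hw.continuousAt.mul (him p hp)
    refine memHW_of_locally_bounded hα hΩ (continuousOn_comp₂ g)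
      (u := fun p => |p.1| ^ α * (D p).im) (v := fun p => (D p).re)
      (fun p hp => (hu p hp.1).continuousWithinAt) (fun p hp => (hre p hp.1).continuousWithinAt)
      (fun p hp _ => hasDerivAt_comp₂_fst hα hΩ g hp (hd p hp))
      (fun p hp _ => hasDerivAt_comp₂_snd hα hΩ g hp (hd p hp)) ?_ ?_ hU hUc hUΩ r
    · intro p hp
      obtain ⟨C, hC⟩ := exists_eventually_abs_le (hu p hp)
      exact ⟨C, hC.mono fun q hq _ => hq⟩
    · intro p hp
      obtain ⟨C, hC⟩ := exists_eventually_abs_le (hre p hp)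
      exact ⟨C, hC.mono fun q hq _ => hq⟩

theorem mem_regularSet_inter_partialsSet {hα : 0 < α} {g : Ω ≃ₜ Ω'}
    (h : IsAxisBiholomorphic hα g) (hΩ : IsOpen Ω) {p : ℝ × ℝ} (hp : p ∈ Ω) (h0 : p.1 ≠ 0) :
    p ∈ regularSet g ∩ partialsSet g :=
  ⟨⟨hp, fun hS => hS.2.elim h0 (h.comp₁_ne_zero hp h0)⟩,
    mem_partialsSet hα hΩ g hp (hasDerivAt_conjugateExt hα hΩ h.differentiableOn hp)
      (h.comp₁_ne_zero hp h0)⟩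

theorem isConformal {hα : 0 < α} {g : Ω ≃ₜ Ω'} (h : IsAxisBiholomorphic hα g)
    (hΩ : IsOpen Ω) (hΩ' : IsOpen Ω') : IsConformal α g := by
  have hne : ∀ p ∈ Ω, deriv (conjugateExt α hα g) (meyerson α hα p) ≠ 0 := fun p hp =>
    deriv_conjugateExt_ne_zero hα hΩ hΩ' g h.differentiableOn hp
  have hM : ∀ p ∈ Ω, p.1 ≠ 0 → grushinMatrix α g p = (|p.1| ^ α / |comp₁ g p| ^ α) •
      mulMatrix (deriv (conjugateExt α hα g) (meyerson α hα p)) := fun p hp h0 =>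
    grushinMatrix_eq hα hΩ g hp (hasDerivAt_conjugateExt hα hΩ h.differentiableOn hp)
      (h.comp₁_ne_zero hp h0)
  refine ⟨h.memHWLoc hΩ hΩ' 2, Eventually.of_forall fun p hp => ?_, fun p hp => ?_⟩
  · have h0 : p.1 ≠ 0 := fun h0 => hp.2 ⟨hp.1, Or.inl h0⟩
    refine ⟨(h.mem_regularSet_inter_partialsSet hΩ hp.1 h0).2, ?_⟩
    rw [hM p hp.1 h0]
    exact exists_smul_orthogonal (hne p hp.1)
      (div_pos (Real.rpow_pos_of_pos (abs_pos.2 h0) α)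
        (Real.rpow_pos_of_pos (abs_pos.2 (h.comp₁_ne_zero hp.1 h0)) α))
  · have hpΩ : p ∈ Ω := hp.1
    have h0 : p.1 = 0 := hp.2.elim id (h.eq_zero_iff p hpΩ).1
    -- Since g₁ vanishes exactly on the axis, R_g is Ω minus the axis, and all partial derivatives
    -- exist there.
    have hfilter : 𝓝[regularSet g ∩ partialsSet g] p = 𝓝[{q | q.1 ≠ 0}] p := by
      refine le_antisymm (nhdsWithin_mono _ fun q hq h0 => hq.1.2 ⟨hq.1.1, Or.inl h0⟩) ?_
      refine nhdsWithin_le_iff.2 ?_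
      filter_upwards [self_mem_nhdsWithin, mem_nhdsWithin_of_mem_nhds (hΩ.mem_nhds hpΩ)]
        with q hq hqΩ using h.mem_regularSet_inter_partialsSet hΩ hqΩ hq
    rw [hfilter]
    constructor
    · have ht : Tendsto (fun t : ℝ => (t, p.2)) (𝓝[≠] 0) (𝓝[{q : ℝ × ℝ | q.1 ≠ 0}] p) := by
        refine Tendsto.inf ?_ (tendsto_principal_principal.2 fun t ht => ht)
        exact Continuous.tendsto' (by fun_prop) _ _ (Prod.ext h0.symm rfl)
      exact ht.neBot
    · obtain ⟨c, hc, hlim⟩ := h.exists_tendsto_ratio hΩ hΩ' hpΩ h0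
      have hJ : Tendsto (fun q => mulMatrix (deriv (conjugateExt α hα g) (meyerson α hα q)))
          (𝓝[{q | q.1 ≠ 0}] p)
          (𝓝 (mulMatrix (deriv (conjugateExt α hα g) (meyerson α hα p)))) :=
        (continuous_mulMatrix.continuousAt.comp (continuousAt_deriv_conjugateExt hα hΩ
          h.differentiableOn hpΩ)).tendsto.mono_left nhdsWithin_le_nhds
      refine ⟨_, smul_ne_zero hc.ne' fun hz => hne p hpΩ (mulMatrix_eq_zero hz),
        (hlim.smul hJ).congr' ?_⟩
      filter_upwards [self_mem_nhdsWithin, mem_nhdsWithin_of_mem_nhds (hΩ.mem_nhds hpΩ)]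
        with q hq hqΩ using (hM q hqΩ hq).symm

theorem isOrientationPreserving {hα : 0 < α} {g : Ω ≃ₜ Ω'} (h : IsAxisBiholomorphic hα g)
    (hΩ : IsOpen Ω) (hΩ' : IsOpen Ω') : IsOrientationPreserving α g := by
  refine ⟨h.memHWLoc hΩ hΩ' 1, ?_⟩
  filter_upwards [ae_fst_ne_zero] with p h0 hp
  refine ⟨(h.mem_regularSet_inter_partialsSet hΩ hp h0).2, ?_⟩
  rw [horizontalMatrix_det_eq hα hΩ g hp (hasDerivAt_conjugateExt hα hΩ h.differentiableOn hp)
    (h.comp₁_ne_zero hp h0)]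
  have h1 := Real.rpow_pos_of_pos (abs_pos.2 h0) α
  have h2 := Real.rpow_pos_of_pos (abs_pos.2 (h.comp₁_ne_zero hp h0)) α
  have h3 : 0 < Complex.normSq (deriv (conjugateExt α hα g) (meyerson α hα p)) :=
    Complex.normSq_pos.2 (deriv_conjugateExt_ne_zero hα hΩ hΩ' g h.differentiableOn hp)
  rw [Complex.normSq_apply] at h3
  have h4 : 0 < (deriv (conjugateExt α hα g) (meyerson α hα p)).re ^ 2 +
      (deriv (conjugateExt α hα g) (meyerson α hα p)).im ^ 2 := by linarith
  positivity

end IsAxisBiholomorphic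

/-! ### Identification of the two classes of maps -/

theorem mem_axisBiholomorphisms_iff (hα : 0 < α) (g : Ω ≃ₜ Ω') :
    conjugate α hα g ∈ axisBiholomorphisms (meyerson α hα '' Ω) (meyerson α hα '' Ω') ↔
      IsAxisBiholomorphic hα g := by
  have haxis : (∀ z : meyerson α hα '' Ω, (conjugate α hα g z : ℂ).re = 0 ↔ (z : ℂ).re = 0) ↔
      ∀ p ∈ Ω, comp₁ g p = 0 ↔ p.1 = 0 := by
    have key : ∀ p (hp : p ∈ Ω), ((conjugate α hα g ⟨meyerson α hα p,
        Set.mem_image_of_mem _ hp⟩ : ℂ).re = 0 ↔ (meyerson α hα p).re = 0) ↔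
        (comp₁ g p = 0 ↔ p.1 = 0) := fun p hp => by
      rw [conjugate_apply hα g ⟨p, hp⟩, meyerson_re, meyerson_re, stretch_eq_zero_iff hα,
        stretch_eq_zero_iff hα, comp₁, ext_apply g hp]
    constructor
    · exact fun H p hp => (key p hp).1 (H ⟨_, Set.mem_image_of_mem _ hp⟩)
    · rintro H ⟨_, p, hp, rfl⟩
      exact (key p hp).2 (H p hp)
  exact ⟨fun H => ⟨H.1, haxis.1 H.2⟩, fun H => ⟨H.1, haxis.2 H.2⟩⟩

theorem mem_grushinConformalMaps_iff (hα : 0 < α) (hΩ : IsOpen Ω) (hΩ' : IsOpen Ω')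
    (g : Ω ≃ₜ Ω') : g ∈ grushinConformalMaps α Ω Ω' ↔ IsAxisBiholomorphic hα g := by
  constructor
  · rintro ⟨hc, ho, -⟩
    have hF := isBiholomorphism_conjugate hα hΩ hc ho
    exact ⟨hF, fun p hp => comp₁_eq_zero_iff hα hΩ hΩ' hc hF hp⟩
  · intro h
    exact ⟨h.isConformal hΩ hΩ', h.isOrientationPreserving hΩ hΩ', h.memHWLoc hΩ hΩ' _⟩

theorem conjugate_bijective (hα : 0 < α) (Ω Ω' : Set (ℝ × ℝ)) :
    Function.Bijective (conjugate α hα : (Ω ≃ₜ Ω') → _) := by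
  constructor
  · intro g g' h
    ext1 p
    have := congrArg (fun k => (k ⟨meyerson α hα p, Set.mem_image_of_mem _ p.2⟩ : ℂ)) h
    simp only [conjugate_apply] at this
    exact Subtype.ext ((meyerson α hα).injective this)
  · intro k
    refine ⟨(((meyerson α hα).image Ω).trans k).trans ((meyerson α hα).image Ω').symm, ?_⟩
    ext1 z
    simp [conjugate]

end Converse

end Grushin

theorem theorem3 (α : ℝ) (hα : 0 < α) (Ω Ω' : Set (ℝ × ℝ)) (hΩ : IsOpen Ω) (hΩ' : IsOpen Ω') :
    Set.BijOn (Grushin.conjugate α hα)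
      (Grushin.grushinConformalMaps α Ω Ω')
      (Grushin.axisBiholomorphisms (Grushin.meyerson α hα '' Ω) (Grushin.meyerson α hα '' Ω')) ∧
    ∀ g ∈ Grushin.grushinConformalMaps α Ω Ω', ∀ p : Ω,
      (g p : ℝ × ℝ).1 = 0 ↔ (p : ℝ × ℝ).1 = 0 := by
  have hiff := Grushin.mem_grushinConformalMaps_iff hα hΩ hΩ'
  have hbij := Grushin.conjugate_bijective hα Ω Ω'
  refine ⟨⟨fun g hg => ?_, hbij.1.injOn, fun k hk => ?_⟩, fun g hg p => ?_⟩
  · exact (Grushin.mem_axisBiholomorphisms_iff hα g).2 ((hiff g).1 hg)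
  · obtain ⟨g, rfl⟩ := hbij.2 k
    exact ⟨g, (hiff g).2 ((Grushin.mem_axisBiholomorphisms_iff hα g).1 hk), rfl⟩
  · have := ((hiff g).1 hg).eq_zero_iff p p.2
    rwa [Grushin.comp₁, Grushin.ext_apply g p.2] at this
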